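/- **Setting.** Let $V$ be a Hilbert space of vector fields on $\mathbb{R}^n$ that is continuously embedded in $C^2_0(\mathbb{R}^n,\mathbb{R}^n)$ (the $C^2$ fields vanishing at infinity together with their derivatives of order one and two), with reproducing kernel $K_V:\mathbb{R}^n\times\mathbb{R}^n\to\mathbb{R}^{n\times n}$, and assume that $K_V(x,x)$ is invertible for every $x$. Let $\gamma>0$. For a finite measure $\mu$ on $\mathbb{R}^n$, $v\in L^2([0,1],V)$ and $\eta\in L^2([0,1],L^2(\mu))$, let $\varphi^v_t$ be the flow $\varphi^v_t(x)=x+\int_0^t v_s(\varphi^v_s(x))\,ds$, let $\tilde\alpha^\eta_t(x)=1+\frac12\int_0^t\eta_s(x)\,ds$, let $\mu_t=\big((\tilde\alpha^\eta_t)^2\circ(\varphi^v_t)^{-1}\big)\,(\varphi^v_t)_\#\mu$, and let $$C_\mu(v,\eta)=\frac12\int_0^1\|v_t\|_V^2\,dt+\frac{\gamma}{2}\int_0^1\int_{\mathbb{R}^n}\big(\eta_t\circ(\varphi^v_t)^{-1}\big)^2\,d\big((\varphi^v_t)_\#\mu\big)\,dt .$$ The LDDMM-Fisher-Rao distance is defined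 by $d_{V-\mathcal{FR}}(\mu,\mu')^2=\inf C_\mu(v,\eta)$, the infimum being over all $(v,\eta)$ with $\mu_1=\mu'$ and $\tilde\alpha^\eta_t\ge 0$ for all $t\in[0,1]$, $\mu$-a.e. A geodesic from $\mu$ to $\mu'$ is the path $t\in[0,1]\mapsto\mu_t$ of a pair $(v,\eta)$ that attains this infimum. Let $d_{K_V}$ be the Riemannian distance on $\mathbb{R}^n$ (infimum of lengths of $C^1$ paths) of the metric $G_x(h,h)=h^TK_V(x,x)^{-1}h$; a $G$-geodesic from $x_0$ to $x_1$ is a $C^1$ curve $x:[0,1]\to\mathbb{R}^n$ with $x(0)=x_0$, $x(1)=x_1$, of constant $G$-speed and of length $d_{K_V}(x_0,x_1)$. **Proposition.** Let $x_0,x_1\in\mathbb{R}^n$, $r_0>0$ and $r_1\ge 0$; if $r_1=0$ (so that $r_1\delta_{x_1}$ is the zero measure, whatever $x_1$ is), take $x_1=x_0$. Then $d_{K_V}(x_0,x_1)$ and $d_{V-\mathcal{FR}}(r_0\delta_{x_0},r_1\delta_{x_1})$ are finite and $$d_{V-\mathcal{FR}}(r_0\delta_{x_0},r_1\delta_{x_1})^2=\frac12\,d_{K_V}(x_0,x_1)^2+2\gamma\,(\sqrt{r_1}-\sqrt{r_0})^2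 .$$ Moreover there is a $G$-geodesic from $x_0$ to $x_1$, and the geodesics from $r_0\delta_{x_0}$ to $r_1\delta_{x_1}$ for $d_{V-\mathcal{FR}}$ are exactly the paths $t\in[0,1]\mapsto r(t)\,\delta_{x(t)}$ where $x(\cdot)$ is a $G$-geodesic from $x_0$ to $x_1$ and $r(t)=\big((1-t)\sqrt{r_0}+t\sqrt{r_1}\big)^2$. -/

import Mathlib

open MeasureTheory Set Filter Topology
open scoped ENNReal Manifold

noncomputable section

/-- The Hilbert space `V` of vector fields on `ℝⁿ` (its elements are read as functions through the
injective coercion of `RKHS`) is continuously embedded in `C²₀(ℝⁿ, ℝⁿ)`: every field is `C²`,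
it vanishes at infinity together with its derivatives of order one and two, and the sup norms of
these derivatives are bounded by a constant times the norm of `V`. -/
structure EmbedsInC20 {n : ℕ} (V : Type*) [NormedAddCommGroup V] [InnerProductSpace ℝ V]
    [RKHS ℝ V (EuclideanSpace ℝ (Fin n)) (EuclideanSpace ℝ (Fin n))] : Prop where
  contDiff : ∀ u : V, ContDiff ℝ 2 (u : EuclideanSpace ℝ (Fin n) → EuclideanSpace ℝ (Fin n))
  vanish : ∀ u : V, ∀ k : ℕ, k ≤ 2 →
    Tendsto (fun x : EuclideanSpace ℝ (Fin n) =>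
      iteratedFDeriv ℝ k (u : EuclideanSpace ℝ (Fin n) → EuclideanSpace ℝ (Fin n)) x)
      (cocompact _) (𝓝 0)
  bound : ∃ c : ℝ, 0 < c ∧ ∀ u : V, ∀ k : ℕ, k ≤ 2 → ∀ x : EuclideanSpace ℝ (Fin n),
    ‖iteratedFDeriv ℝ k (u : EuclideanSpace ℝ (Fin n) → EuclideanSpace ℝ (Fin n)) x‖ ≤ c * ‖u‖

/-! ### The Riemannian metric given by the inverse of the kernel on the diagonal -/

/-- The metric `G_x(h, h') = hᵀ K_V(x, x)⁻¹ h'` on `ℝⁿ`, where `K_V` is the reproducing kernel of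
`V`. -/
def kernelMetric {n : ℕ} (V : Type*) [NormedAddCommGroup V] [InnerProductSpace ℝ V]
    [CompleteSpace V] [RKHS ℝ V (EuclideanSpace ℝ (Fin n)) (EuclideanSpace ℝ (Fin n))]
    (x h h' : EuclideanSpace ℝ (Fin n)) : ℝ :=
  inner ℝ h ((RKHS.kernel V x x).inverse h')

/-- The Riemannian length `√(G_x(h, h))` of a tangent vector `h` at `x`. -/
def kernelSpeed {n : ℕ} (V : Type*) [NormedAddCommGroup V] [InnerProductSpace ℝ V]
    [CompleteSpace V] [RKHS ℝ V (EuclideanSpace ℝ (Fin n)) (EuclideanSpace ℝ (Fin n))]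
    (x h : EuclideanSpace ℝ (Fin n)) : ℝ≥0∞ :=
  ENNReal.ofReal (√(kernelMetric V x h h))

/-- The Riemannian distance of the metric `G`: the infimum of the `G`-lengths of the `C¹` paths
from `x` to `y`. -/
def kernelEDist {n : ℕ} (V : Type*) [NormedAddCommGroup V] [InnerProductSpace ℝ V]
    [CompleteSpace V] [RKHS ℝ V (EuclideanSpace ℝ (Fin n)) (EuclideanSpace ℝ (Fin n))]
    (x y : EuclideanSpace ℝ (Fin n)) : ℝ≥0∞ :=
  letI : ∀ z : EuclideanSpace ℝ (Fin n),
      ENorm (TangentSpace 𝓘(ℝ, EuclideanSpace ℝ (Fin n)) z) := fun z => ⟨kernelSpeed V z⟩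
  Manifold.riemannianEDist 𝓘(ℝ, EuclideanSpace ℝ (Fin n)) x y

/-- `x : [0, 1] → ℝⁿ` is a (minimizing) geodesic from `x₀` to `x₁` for the metric `G`: a `C¹` curve
of constant speed whose length is the distance of its end points. -/
structure IsKernelGeodesic {n : ℕ} (V : Type*) [NormedAddCommGroup V] [InnerProductSpace ℝ V]
    [CompleteSpace V] [RKHS ℝ V (EuclideanSpace ℝ (Fin n)) (EuclideanSpace ℝ (Fin n))]
    (x₀ x₁ : EuclideanSpace ℝ (Fin n)) (x : ℝ → EuclideanSpace ℝ (Fin n)) : Prop where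
  contDiffOn : ContDiffOn ℝ 1 x (Icc 0 1)
  source : x 0 = x₀
  target : x 1 = x₁
  speed : ∀ t ∈ Icc (0 : ℝ) 1,
    kernelSpeed V (x t) (derivWithin x (Icc 0 1) t) = kernelEDist V x₀ x₁

/-! ### The LDDMM-Fisher-Rao distance between `0`-varifolds, i.e. finite measures on `ℝⁿ` -/

/-- `φ` is the flow on `[0, 1]` of the time-dependent vector field `v`:
`φ_t(x) = x + ∫₀ᵗ v_s(φ_s(x)) ds` for every `x`. -/
def IsFlow {n : ℕ} {V : Type*} [NormedAddCommGroup V] [InnerProductSpace ℝ V]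
    [RKHS ℝ V (EuclideanSpace ℝ (Fin n)) (EuclideanSpace ℝ (Fin n))]
    (v : ℝ → V) (φ : ℝ → EuclideanSpace ℝ (Fin n) ≃ₜ EuclideanSpace ℝ (Fin n)) : Prop :=
  ∀ x : EuclideanSpace ℝ (Fin n),
    IntervalIntegrable (fun s => v s (φ s x)) volume 0 1 ∧
    ∀ t ∈ Icc (0 : ℝ) 1, φ t x = x + ∫ s in (0 : ℝ)..t, v s (φ s x)

/-- `α̃_t(x) = 1 + ½ ∫₀ᵗ η_s(x) ds`, the square root of the weight change function. -/
def sqrtWeight {n : ℕ} (η : ℝ → EuclideanSpace ℝ (Fin n) → ℝ) (t : ℝ)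
    (x : EuclideanSpace ℝ (Fin n)) : ℝ :=
  1 + (1 / 2) * ∫ s in (0 : ℝ)..t, η s x

/-- The transformed measure `((α̃_t)² ∘ φ_t⁻¹) · (φ_t)_# μ`.  For measures without tangential
part the push-forward `(φ_t)_# μ` carries no Jacobian factor: it is the image measure. -/
def transformedMeasure {n : ℕ} (μ : Measure (EuclideanSpace ℝ (Fin n)))
    (φ : ℝ → EuclideanSpace ℝ (Fin n) ≃ₜ EuclideanSpace ℝ (Fin n))
    (η : ℝ → EuclideanSpace ℝ (Fin n) → ℝ) (t : ℝ) : Measure (EuclideanSpace ℝ (Fin n)) :=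
  (μ.map (φ t)).withDensity
    (fun y => ENNReal.ofReal ((sqrtWeight η t ((φ t).symm y)) ^ 2))

/-- `(v, η)` is an admissible control from `μ` to `μ'` with flow `φ`: `v ∈ L²([0,1], V)`,
`η ∈ L²([0,1], L²(μ))`, `α̃_t ≥ 0` for all `t`, `μ`-almost everywhere, and the measure
transformed up to time `1` is `μ'`. -/
structure IsAdmissible {n : ℕ} {V : Type*} [NormedAddCommGroup V] [InnerProductSpace ℝ V]
    [RKHS ℝ V (EuclideanSpace ℝ (Fin n)) (EuclideanSpace ℝ (Fin n))]
    (μ μ' : Measure (EuclideanSpace ℝ (Fin n))) (v : ℝ → V)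
    (η : ℝ → EuclideanSpace ℝ (Fin n) → ℝ)
    (φ : ℝ → EuclideanSpace ℝ (Fin n) ≃ₜ EuclideanSpace ℝ (Fin n)) : Prop where
  memLp_v : MemLp v 2 (volume.restrict (Icc (0 : ℝ) 1))
  memLp_η : MemLp (fun p : ℝ × EuclideanSpace ℝ (Fin n) => η p.1 p.2) 2
    ((volume.restrict (Icc (0 : ℝ) 1)).prod μ)
  flow : IsFlow v φ
  nonneg : ∀ᵐ x ∂μ, ∀ t ∈ Icc (0 : ℝ) 1, 0 ≤ sqrtWeight η t x
  target : transformedMeasure μ φ η 1 = μ'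

/-- The cost `½ ∫₀¹ ‖v_t‖²_V dt + (γ/2) ∫₀¹ ∫ (η_t ∘ φ_t⁻¹)² d((φ_t)_# μ) dt`. -/
def lddmmFRCost {n : ℕ} {V : Type*} [NormedAddCommGroup V] (γ : ℝ)
    (μ : Measure (EuclideanSpace ℝ (Fin n))) (v : ℝ → V)
    (η : ℝ → EuclideanSpace ℝ (Fin n) → ℝ)
    (φ : ℝ → EuclideanSpace ℝ (Fin n) ≃ₜ EuclideanSpace ℝ (Fin n)) : ℝ≥0∞ :=
  ENNReal.ofReal (1 / 2) * (∫⁻ t in Icc (0 : ℝ) 1, ‖v t‖ₑ ^ 2) +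
    ENNReal.ofReal (γ / 2) *
      ∫⁻ t in Icc (0 : ℝ) 1, ∫⁻ y, ‖η t ((φ t).symm y)‖ₑ ^ 2 ∂(μ.map (φ t))

/-- The LDDMM-Fisher-Rao distance: the square root of the infimum of the cost over all admissible
controls from `μ` to `μ'` (`∞` if there is none). -/
def lddmmFREDist {n : ℕ} (V : Type*) [NormedAddCommGroup V] [InnerProductSpace ℝ V]
    [RKHS ℝ V (EuclideanSpace ℝ (Fin n)) (EuclideanSpace ℝ (Fin n))] (γ : ℝ)
    (μ μ' : Measure (EuclideanSpace ℝ (Fin n))) : ℝ≥0∞ :=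
  (⨅ (v : ℝ → V) (η : ℝ → EuclideanSpace ℝ (Fin n) → ℝ)
    (φ : ℝ → EuclideanSpace ℝ (Fin n) ≃ₜ EuclideanSpace ℝ (Fin n))
    (_ : IsAdmissible μ μ' v η φ), lddmmFRCost γ μ v η φ) ^ (1 / 2 : ℝ)

/-- A path of measures `t ∈ [0, 1] ↦ m t` is a geodesic from `μ` to `μ'` for the LDDMM-Fisher-Rao
distance: it is the path of transformed measures of an optimal control. -/
def IsLDDMMFRGeodesic {n : ℕ} (V : Type*) [NormedAddCommGroup V] [InnerProductSpace ℝ V]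
    [RKHS ℝ V (EuclideanSpace ℝ (Fin n)) (EuclideanSpace ℝ (Fin n))] (γ : ℝ)
    (μ μ' : Measure (EuclideanSpace ℝ (Fin n)))
    (m : ℝ → Measure (EuclideanSpace ℝ (Fin n))) : Prop :=
  ∃ (v : ℝ → V) (η : ℝ → EuclideanSpace ℝ (Fin n) → ℝ)
    (φ : ℝ → EuclideanSpace ℝ (Fin n) ≃ₜ EuclideanSpace ℝ (Fin n)),
    IsAdmissible μ μ' v η φ ∧
    lddmmFREDist V γ μ μ' = (lddmmFRCost γ μ v η φ) ^ (1 / 2 : ℝ) ∧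
    ∀ t ∈ Icc (0 : ℝ) 1, m t = transformedMeasure μ φ η t

end

/-! By the reproducing property, evaluation at `x` maps `V` onto `ℝⁿ`, and `G_x` is the resulting
quotient metric: a field with value `h` at `x` has norm at least `√(G_x(h, h))`, with equality for
the minimal lift `K_V(·, x) K_V(x, x)⁻¹ h`. Hence a flow line of `v` between times `s` and `t` moves
by at most `∫ ‖v‖` in the kernel distance (`kernelDist_le_integral_norm`).

For a multiple of a Dirac mass only the material point `x₀` is seen, so the cost splits into `½ ∫
‖v‖²` and `(γ/2) r₀ ∫ η(x₀)²`. The end point bounds `∫ ‖v‖` from below by the distance, and the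
final mass, together with the sign condition, prescribes `√r₀ ∫ η(x₀) = 2 (√r₁ - √r₀)`.
Cauchy-Schwarz in each term gives the lower bound. Equality makes `‖v‖` and `η(x₀)` almost
everywhere constant: the flow line is then Lipschitz with the distance of its end points as
constant, and the square root of the mass is affine. Conversely, the minimal lifts of the velocities
of a geodesic form a continuous curve in `V`, whose flow carries `x₀` along the geodesic at exactly
the minimal cost.

The analytic work is that a Lipschitz minimizer is `C¹` and that one exists. No geodesic equation is
used. The tangent norms depend on the base point in a locally Lipschitz way
(`exists_norm_minLift_le_mul`), and strict convexity of a Hilbert norm then keeps a minimizer within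
`O(τ^(3/2))` of its chords over intervals of length `τ`, which forces `C¹`
(`exists_deriv_of_kernelDist_eq`). Existence follows from compactness of Euclidean balls, since the
kernel distance dominates a multiple of the Euclidean one. -/

noncomputable section

/-! ### Minimal lifts of tangent vectors to `V`. -/

section MinimalLift

variable {n : ℕ} {V : Type*} [NormedAddCommGroup V] [InnerProductSpace ℝ V]
  [RKHS ℝ V (EuclideanSpace ℝ (Fin n)) (EuclideanSpace ℝ (Fin n))]

local notation "𝔼" => EuclideanSpace ℝ (Fin n)

/-- A common bound for the values and the Lipschitz constants of the fields of `V`. -/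
lemma EmbedsInC20.exists_bound (hV : EmbedsInC20 V) :
    ∃ c : ℝ, 0 < c ∧ (∀ (u : V) (x : 𝔼), ‖u x‖ ≤ c * ‖u‖) ∧
      ∀ (u : V) (x y : 𝔼), ‖u x - u y‖ ≤ c * ‖u‖ * ‖x - y‖ := by
  obtain ⟨c, hc, h⟩ := hV.bound
  refine ⟨c, hc, fun u x => by simpa using h u 0 (by norm_num) x, fun u x y => ?_⟩
  refine Convex.norm_image_sub_le_of_norm_fderiv_le (𝕜 := ℝ) (s := univ) (f := (u : 𝔼 → 𝔼))
    (fun z _ => (hV.contDiff u).differentiable (by norm_num) z) (fun z _ => ?_)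
    convex_univ (mem_univ y) (mem_univ x)
  have := h u 1 (by norm_num) z
  rwa [norm_iteratedFDeriv_one] at this

variable [CompleteSpace V]

variable (V) in
/-- The field of minimal norm in `V` among those taking the value `h` at `x`. -/
def minLift (x : 𝔼) : 𝔼 →L[ℝ] V :=
  RKHS.kerFun V x ∘L (RKHS.kernel V x x).inverse

lemma minLift_apply_self {x : 𝔼} (hx : (RKHS.kernel V x x).IsInvertible) (h : 𝔼) :
    minLift V x h x = h := by
  simp [minLift, RKHS.kerFun_apply, hx.self_apply_inverse]

/-- The difference of `u` and the lift of `u x` vanishes at `x`, so it is orthogonal to the range of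
`kerFun V x`, where the lift lies. -/
lemma inner_minLift_minLift {x : 𝔼} (hx : (RKHS.kernel V x x).IsInvertible) (u : V) :
    inner ℝ (minLift V x (u x)) u = inner ℝ (minLift V x (u x)) (minLift V x (u x)) := by
  conv_lhs => simp only [minLift, ContinuousLinearMap.comp_apply, RKHS.kerFun_inner]
  conv_rhs => rw [show minLift V x (u x) = RKHS.kerFun V x
    ((RKHS.kernel V x x).inverse (u x)) from rfl]
  conv_rhs => rw [RKHS.kerFun_inner, RKHS.kerFun_apply, hx.self_apply_inverse]

lemma norm_minLift_le {x : 𝔼} (hx : (RKHS.kernel V x x).IsInvertible) (u : V) :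
    ‖minLift V x (u x)‖ ≤ ‖u‖ := by
  have h := inner_minLift_minLift hx u
  rw [real_inner_self_eq_norm_sq] at h
  have h2 := real_inner_le_norm (minLift V x (u x)) u
  by_contra! hlt
  have : 0 < ‖minLift V x (u x)‖ := (norm_nonneg u).trans_lt hlt
  nlinarith

lemma kernelMetric_self {x : 𝔼} (hx : (RKHS.kernel V x x).IsInvertible) (h : 𝔼) :
    kernelMetric V x h h = ‖minLift V x h‖ ^ 2 := by
  rw [kernelMetric, ← real_inner_self_eq_norm_sq]
  rw [show minLift V x h = RKHS.kerFun V x ((RKHS.kernel V x x).inverse h) from rfl]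
  rw [RKHS.kerFun_inner, RKHS.kerFun_apply, hx.self_apply_inverse, real_inner_comm]

lemma kernelSpeed_eq {x : 𝔼} (hx : (RKHS.kernel V x x).IsInvertible) (h : 𝔼) :
    kernelSpeed V x h = ‖minLift V x h‖ₑ := by
  rw [kernelSpeed, kernelMetric_self hx, Real.sqrt_sq (norm_nonneg _), ofReal_norm]

lemma norm_le_mul_norm_minLift {x : 𝔼} (hx : (RKHS.kernel V x x).IsInvertible) {c : ℝ}
    (hc : ∀ (u : V) (x : 𝔼), ‖u x‖ ≤ c * ‖u‖) (h : 𝔼) : ‖h‖ ≤ c * ‖minLift V x h‖ := by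
  simpa [minLift_apply_self hx] using hc (minLift V x h) x

/-- The adjoint of `kerFun V x` is evaluation at `x`, so the uniform Lipschitz bound on the fields
is a Lipschitz bound for `x ↦ kerFun V x` in operator norm. -/
lemma continuous_kerFun (hV : EmbedsInC20 V) : Continuous (fun x : 𝔼 => RKHS.kerFun V x) := by
  obtain ⟨c, hc, -, h⟩ := hV.exists_bound
  refine (LipschitzWith.of_dist_le_mul (K := ⟨c, hc.le⟩) fun x y => ?_).continuous
  rw [dist_eq_norm, dist_eq_norm, ← (ContinuousLinearMap.adjoint).norm_map, map_sub]
  refine ContinuousLinearMap.opNorm_le_bound _ (by positivity) fun u => ?_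
  simp only [sub_apply, RKHS.adjoint_kerFun]
  refine (h u x y).trans_eq ?_
  change _ = c * ‖x - y‖ * ‖u‖
  ring

lemma continuous_minLift (hV : EmbedsInC20 V)
    (hK : ∀ x : 𝔼, (RKHS.kernel V x x).IsInvertible) : Continuous (fun x : 𝔼 => minLift V x) := by
  have hk := continuous_kerFun hV
  refine hk.clm_comp ?_
  have hd : Continuous (fun x : 𝔼 => RKHS.kernel V x x) := by
    simp only [RKHS.kernel_apply]
    exact ((ContinuousLinearMap.adjoint (𝕜 := ℝ) (E := 𝔼) (F := V)).continuous.comp hk).clm_comp hk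
  rw [continuous_iff_continuousAt]
  intro x
  exact ContinuousAt.comp (f := fun x : 𝔼 => RKHS.kernel V x x)
    ((hK x).contDiffAt_map_inverse (n := 0)).continuousAt hd.continuousAt

lemma exists_norm_minLift_le (hV : EmbedsInC20 V)
    (hK : ∀ x : 𝔼, (RKHS.kernel V x x).IsInvertible) (R : ℝ) :
    ∃ A : ℝ, 0 < A ∧ ∀ y : 𝔼, ‖y‖ ≤ R → ∀ h, ‖minLift V y h‖ ≤ A * ‖h‖ := by
  obtain ⟨A, hA⟩ := (isCompact_closedBall (0 : 𝔼) R).exists_bound_of_continuousOn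
    (continuous_minLift hV hK).continuousOn
  refine ⟨max A 1, by positivity, fun y hy h => ?_⟩
  refine (minLift V y).le_of_opNorm_le ?_ h
  exact (hA y (by simpa using hy)).trans (le_max_left _ _)

/-- On a ball, the norms `h ↦ ‖minLift V y h‖` vary with `y` in a Lipschitz way, up to a factor. -/
lemma exists_norm_minLift_le_mul (hV : EmbedsInC20 V)
    (hK : ∀ x : 𝔼, (RKHS.kernel V x x).IsInvertible) (R : ℝ) :
    ∃ B : ℝ, 0 < B ∧ ∀ y : 𝔼, ‖y‖ ≤ R → ∀ x h : 𝔼,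
      ‖minLift V y h‖ ≤ (1 + B * ‖y - x‖) * ‖minLift V x h‖ := by
  obtain ⟨c, hc, -, hl⟩ := hV.exists_bound
  obtain ⟨A, hA, hAb⟩ := exists_norm_minLift_le hV hK R
  refine ⟨A * c, by positivity, fun y hy x h => ?_⟩
  -- The optimal field at `x` serves as competitor at `y`: it takes the value `h` there up to an
  -- error of size `c * ‖u‖ * ‖x - y‖`, which is lifted separately.
  set u := minLift V x h with hu
  have hux : u x = h := minLift_apply_self (hK x) h
  calc ‖minLift V y h‖ = ‖minLift V y (u y) + minLift V y (u x - u y)‖ := by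
        rw [← map_add, hux]; simp
    _ ≤ ‖minLift V y (u y)‖ + ‖minLift V y (u x - u y)‖ := norm_add_le _ _
    _ ≤ ‖u‖ + A * (c * ‖u‖ * ‖x - y‖) := by
        gcongr
        · exact norm_minLift_le (hK y) u
        · exact (hAb y hy _).trans (by gcongr; exact hl u x y)
    _ = _ := by rw [norm_sub_rev]; ring

end MinimalLift

/-! ### The kernel distance and its comparison with the tangent norms. -/

section KernelDist

variable {n : ℕ} {V : Type*} [NormedAddCommGroup V] [InnerProductSpace ℝ V] [CompleteSpace V]
  [RKHS ℝ V (EuclideanSpace ℝ (Fin n)) (EuclideanSpace ℝ (Fin n))]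

local notation "𝔼" => EuclideanSpace ℝ (Fin n)

lemma contDiffOn_one_Icc_of_hasDerivWithinAt {F : Type*} [NormedAddCommGroup F] [NormedSpace ℝ F]
    {γ γ' : ℝ → F} {a b : ℝ} (hab : a < b)
    (hγ : ∀ t ∈ Icc a b, HasDerivWithinAt γ (γ' t) (Icc a b) t)
    (hγ' : ContinuousOn γ' (Icc a b)) : ContDiffOn ℝ 1 γ (Icc a b) := by
  refine (contDiffOn_one_iff_derivWithin (uniqueDiffOn_Icc hab)).2
    ⟨fun t ht => (hγ t ht).differentiableWithinAt, hγ'.congr fun t ht => ?_⟩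
  exact (hγ t ht).derivWithin (uniqueDiffOn_Icc hab t ht)

lemma integral_eq_sub_of_hasDerivWithinAt_Icc {F : Type*} [NormedAddCommGroup F] [NormedSpace ℝ F]
    [CompleteSpace F] {γ γ' : ℝ → F} {a b s t : ℝ}
    (hγ : ∀ t ∈ Icc a b, HasDerivWithinAt γ (γ' t) (Icc a b) t)
    (hγ' : ContinuousOn γ' (Icc a b)) (hs : a ≤ s) (hst : s ≤ t) (ht : t ≤ b) :
    ∫ r in s..t, γ' r = γ t - γ s := by
  have hsub : Icc s t ⊆ Icc a b := Icc_subset_Icc hs ht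
  refine intervalIntegral.integral_eq_sub_of_hasDerivAt_of_le hst
    (fun r hr => (hγ r (hsub hr)).continuousWithinAt.mono hsub) (fun r hr => ?_)
    ((hγ'.mono hsub).intervalIntegrable_of_Icc hst)
  exact (hγ r (hsub (Ioo_subset_Icc_self hr))).hasDerivAt
    (Icc_mem_nhds (hs.trans_lt hr.1) (hr.2.trans_le ht))

lemma kernelSpeed_smul (hK : ∀ x : 𝔼, (RKHS.kernel V x x).IsInvertible) (x : 𝔼) (r : ℝ) (h : 𝔼) :
    kernelSpeed V x (r • h) = ‖r‖ₑ * kernelSpeed V x h := by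
  rw [kernelSpeed_eq (hK x), kernelSpeed_eq (hK x), map_smul, enorm_smul]

/-- Homogeneity of the tangent norms, required by the general results on `Manifold.riemannianEDist`.
-/
lemma enormSMulClass_kernelSpeed (hK : ∀ x : 𝔼, (RKHS.kernel V x x).IsInvertible) (x : 𝔼) :
    @ENormSMulClass ℝ (TangentSpace 𝓘(ℝ, 𝔼) x) _ ⟨kernelSpeed V x⟩ _ :=
  @ENormSMulClass.mk ℝ (TangentSpace 𝓘(ℝ, 𝔼) x) _ ⟨kernelSpeed V x⟩ _ (fun r h => by
    exact kernelSpeed_smul hK x r h)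

lemma kernelEDist_self (hK : ∀ x : 𝔼, (RKHS.kernel V x x).IsInvertible) (x : 𝔼) :
    kernelEDist V x x = 0 := by
  let _ : ∀ z : 𝔼, ENorm (TangentSpace 𝓘(ℝ, 𝔼) z) := fun z => ⟨kernelSpeed V z⟩
  have := enormSMulClass_kernelSpeed hK
  exact Manifold.riemannianEDist_self

lemma kernelEDist_comm (hK : ∀ x : 𝔼, (RKHS.kernel V x x).IsInvertible) (x y : 𝔼) :
    kernelEDist V x y = kernelEDist V y x := by
  let _ : ∀ z : 𝔼, ENorm (TangentSpace 𝓘(ℝ, 𝔼) z) := fun z => ⟨kernelSpeed V z⟩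
  have := enormSMulClass_kernelSpeed hK
  exact Manifold.riemannianEDist_comm

lemma kernelEDist_triangle (hK : ∀ x : 𝔼, (RKHS.kernel V x x).IsInvertible) (x y z : 𝔼) :
    kernelEDist V x z ≤ kernelEDist V x y + kernelEDist V y z := by
  let _ : ∀ z : 𝔼, ENorm (TangentSpace 𝓘(ℝ, 𝔼) z) := fun z => ⟨kernelSpeed V z⟩
  have := enormSMulClass_kernelSpeed hK
  exact Manifold.riemannianEDist_triangle

lemma continuousOn_norm_minLift (hV : EmbedsInC20 V)
    (hK : ∀ x : 𝔼, (RKHS.kernel V x x).IsInvertible) {γ γ' : ℝ → 𝔼} {s : Set ℝ}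
    (hγ : ContinuousOn γ s) (hγ' : ContinuousOn γ' s) :
    ContinuousOn (fun t => ‖minLift V (γ t) (γ' t)‖) s :=
  (((continuous_minLift hV hK).comp_continuousOn hγ).clm_apply hγ').norm

lemma lintegral_kernelSpeed_derivWithin (hV : EmbedsInC20 V)
    (hK : ∀ x : 𝔼, (RKHS.kernel V x x).IsInvertible) {γ γ' : ℝ → 𝔼} {a b : ℝ} (hab : a < b)
    (hγ : ∀ t ∈ Icc a b, HasDerivWithinAt γ (γ' t) (Icc a b) t)
    (hγ' : ContinuousOn γ' (Icc a b)) :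
    ∫⁻ t in Icc a b, kernelSpeed V (γ t) (derivWithin γ (Icc a b) t) =
      ENNReal.ofReal (∫ t in a..b, ‖minLift V (γ t) (γ' t)‖) := by
  have hγc : ContinuousOn γ (Icc a b) := fun t ht => (hγ t ht).continuousWithinAt
  have hc : ContinuousOn (fun t => minLift V (γ t) (γ' t)) (Icc a b) :=
    ((continuous_minLift hV hK).comp_continuousOn hγc).clm_apply hγ'
  rw [intervalIntegral.integral_of_le hab.le, ← integral_Icc_eq_integral_Ioc,
    ofReal_integral_norm_eq_lintegral_enorm (hc.integrableOn_Icc)]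
  refine setLIntegral_congr_fun measurableSet_Icc fun t ht => ?_
  rw [kernelSpeed_eq (hK _), (hγ t ht).derivWithin (uniqueDiffOn_Icc hab t ht)]

lemma kernelEDist_le_integral (hV : EmbedsInC20 V)
    (hK : ∀ x : 𝔼, (RKHS.kernel V x x).IsInvertible) {γ γ' : ℝ → 𝔼} {a b : ℝ} (hab : a ≤ b)
    (hγ : ∀ t ∈ Icc a b, HasDerivWithinAt γ (γ' t) (Icc a b) t)
    (hγ' : ContinuousOn γ' (Icc a b)) :
    kernelEDist V (γ a) (γ b) ≤ ENNReal.ofReal (∫ t in a..b, ‖minLift V (γ t) (γ' t)‖) := by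
  rcases hab.eq_or_lt with rfl | hab'
  · simp [kernelEDist_self hK]
  let _ : ∀ z : 𝔼, ENorm (TangentSpace 𝓘(ℝ, 𝔼) z) := fun z => ⟨kernelSpeed V z⟩
  have := enormSMulClass_kernelSpeed hK
  have h := Manifold.riemannianEDist_le_pathELength (I := 𝓘(ℝ, 𝔼)) (γ := γ)
    (contMDiffOn_iff_contDiffOn.2 (contDiffOn_one_Icc_of_hasDerivWithinAt hab' hγ hγ'))
    rfl rfl hab
  refine h.trans_eq ?_
  rw [← lintegral_kernelSpeed_derivWithin hV hK hab' hγ hγ',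
    Manifold.pathELength_eq_lintegral_mfderivWithin_Icc]
  refine setLIntegral_congr_fun measurableSet_Icc fun t _ => ?_
  simp only [mfderivWithin_eq_fderivWithin]
  rw [← fderivWithin_derivWithin]
  rfl

lemma exists_path_of_kernelEDist_lt (hV : EmbedsInC20 V)
    (hK : ∀ x : 𝔼, (RKHS.kernel V x x).IsInvertible) {x y : 𝔼} {r : ℝ}
    (hr : kernelEDist V x y < ENNReal.ofReal r) :
    ∃ γ γ' : ℝ → 𝔼, (∀ t ∈ Icc (0 : ℝ) 1, HasDerivWithinAt γ (γ' t) (Icc 0 1) t) ∧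
      ContinuousOn γ' (Icc 0 1) ∧ γ 0 = x ∧ γ 1 = y ∧
      ∫ t in (0 : ℝ)..1, ‖minLift V (γ t) (γ' t)‖ < r := by
  let _ : ∀ z : 𝔼, ENorm (TangentSpace 𝓘(ℝ, 𝔼) z) := fun z => ⟨kernelSpeed V z⟩
  obtain ⟨γ, h0, h1, hγ, hlt⟩ := Manifold.exists_lt_of_riemannianEDist_lt hr
  rw [contMDiffOn_iff_contDiffOn, contDiffOn_one_iff_derivWithin (uniqueDiffOn_Icc one_pos)] at hγ
  have hd : ∀ t ∈ Icc (0 : ℝ) 1, HasDerivWithinAt γ (derivWithin γ (Icc 0 1) t) (Icc 0 1) t :=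
    fun t ht => (hγ.1 t ht).hasDerivWithinAt
  refine ⟨γ, derivWithin γ (Icc 0 1), hd, hγ.2, h0, h1, ?_⟩
  refine (ENNReal.ofReal_lt_ofReal_iff' (q := r)).1 ?_ |>.1
  rw [← lintegral_kernelSpeed_derivWithin hV hK one_pos hd hγ.2]
  refine lt_of_eq_of_lt ?_ hlt
  rw [Manifold.pathELength_eq_lintegral_mfderivWithin_Icc]
  refine setLIntegral_congr_fun measurableSet_Icc fun t _ => ?_
  simp only [mfderivWithin_eq_fderivWithin]
  rw [← fderivWithin_derivWithin]
  rfl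

lemma hasDerivWithinAt_segment (y z : 𝔼) (s : Set ℝ) (t : ℝ) :
    HasDerivWithinAt (fun t : ℝ => y + t • (z - y)) (z - y) s t := by
  simpa using (((hasDerivAt_id t).smul_const (z - y)).const_add y).hasDerivWithinAt

lemma kernelEDist_ne_top (hV : EmbedsInC20 V)
    (hK : ∀ x : 𝔼, (RKHS.kernel V x x).IsInvertible) (x y : 𝔼) : kernelEDist V x y ≠ ∞ := by
  have := kernelEDist_le_integral hV hK (zero_le_one' ℝ)
    (fun t _ => hasDerivWithinAt_segment x y _ t) continuousOn_const
  simp only [zero_smul, add_zero, one_smul, add_sub_cancel] at this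
  exact ne_top_of_le_ne_top ENNReal.ofReal_ne_top this

variable (V) in
/-- The Riemannian distance of the kernel metric as a real number. -/
def kernelDist (x y : 𝔼) : ℝ := (kernelEDist V x y).toReal

lemma kernelDist_nonneg (x y : 𝔼) : 0 ≤ kernelDist V x y := ENNReal.toReal_nonneg

lemma kernelDist_self (hK : ∀ x : 𝔼, (RKHS.kernel V x x).IsInvertible) (x : 𝔼) :
    kernelDist V x x = 0 := by simp [kernelDist, kernelEDist_self hK]

lemma kernelDist_comm (hK : ∀ x : 𝔼, (RKHS.kernel V x x).IsInvertible) (x y : 𝔼) :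
    kernelDist V x y = kernelDist V y x := by simp [kernelDist, kernelEDist_comm hK x y]

lemma kernelDist_triangle (hV : EmbedsInC20 V)
    (hK : ∀ x : 𝔼, (RKHS.kernel V x x).IsInvertible) (x y z : 𝔼) :
    kernelDist V x z ≤ kernelDist V x y + kernelDist V y z := by
  have hxy := kernelEDist_ne_top hV hK x y
  have hyz := kernelEDist_ne_top hV hK y z
  rw [kernelDist, kernelDist, kernelDist, ← ENNReal.toReal_add hxy hyz]
  exact ENNReal.toReal_mono (ENNReal.add_ne_top.2 ⟨hxy, hyz⟩) (kernelEDist_triangle hK x y z)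

lemma kernelDist_le_integral (hV : EmbedsInC20 V)
    (hK : ∀ x : 𝔼, (RKHS.kernel V x x).IsInvertible) {γ γ' : ℝ → 𝔼} {a b : ℝ} (hab : a ≤ b)
    (hγ : ∀ t ∈ Icc a b, HasDerivWithinAt γ (γ' t) (Icc a b) t)
    (hγ' : ContinuousOn γ' (Icc a b)) :
    kernelDist V (γ a) (γ b) ≤ ∫ t in a..b, ‖minLift V (γ t) (γ' t)‖ :=
  ENNReal.toReal_le_of_le_ofReal
    (intervalIntegral.integral_nonneg hab fun _ _ => norm_nonneg _)
    (kernelEDist_le_integral hV hK hab hγ hγ')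

lemma exists_path_of_kernelDist_lt (hV : EmbedsInC20 V)
    (hK : ∀ x : 𝔼, (RKHS.kernel V x x).IsInvertible) {x y : 𝔼} {r : ℝ}
    (hr : kernelDist V x y < r) :
    ∃ γ γ' : ℝ → 𝔼, (∀ t ∈ Icc (0 : ℝ) 1, HasDerivWithinAt γ (γ' t) (Icc 0 1) t) ∧
      ContinuousOn γ' (Icc 0 1) ∧ γ 0 = x ∧ γ 1 = y ∧
      ∫ t in (0 : ℝ)..1, ‖minLift V (γ t) (γ' t)‖ < r :=
  exists_path_of_kernelEDist_lt hV hK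
    ((ENNReal.lt_ofReal_iff_toReal_lt (kernelEDist_ne_top hV hK x y)).2 hr)

/-- Upper bound of the distance by the length of the segment. -/
lemma kernelDist_le_mul_norm_minLift (hV : EmbedsInC20 V)
    (hK : ∀ x : 𝔼, (RKHS.kernel V x x).IsInvertible) {R B : ℝ} (hB : 0 ≤ B)
    (h : ∀ y : 𝔼, ‖y‖ ≤ R → ∀ x h : 𝔼,
      ‖minLift V y h‖ ≤ (1 + B * ‖y - x‖) * ‖minLift V x h‖)
    {y z : 𝔼} (hy : ‖y‖ ≤ R) (hz : ‖z‖ ≤ R) :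
    kernelDist V y z ≤ (1 + B * ‖z - y‖) * ‖minLift V y (z - y)‖ := by
  have hd := fun t (_ : t ∈ Icc (0 : ℝ) 1) => hasDerivWithinAt_segment y z (Icc 0 1) t
  have h1 := kernelDist_le_integral hV hK zero_le_one hd continuousOn_const
  simp only [zero_smul, add_zero, one_smul, add_sub_cancel] at h1
  refine h1.trans ?_
  have h2 := intervalIntegral.integral_mono_on (μ := volume)
    (f := fun t => ‖minLift V (y + t • (z - y)) (z - y)‖) (zero_le_one' ℝ)
    ((continuousOn_norm_minLift hV hK (fun t ht => (hd t ht).continuousWithinAt)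
      continuousOn_const).intervalIntegrable_of_Icc zero_le_one)
    (intervalIntegrable_const (c := (1 + B * ‖z - y‖) * ‖minLift V y (z - y)‖)) (fun t ht => by
      have hmem : y + t • (z - y) ∈ Metric.closedBall (0 : 𝔼) R :=
        (convex_closedBall (0 : 𝔼) R).add_smul_sub_mem (by simpa using hy) (by simpa using hz) ht
      refine (h _ (by simpa using hmem) y _).trans ?_
      gcongr
      rw [add_sub_cancel_left, norm_smul, Real.norm_of_nonneg ht.1]
      exact mul_le_of_le_one_left (norm_nonneg _) ht.2)
  simpa using h2

/-- Evaluation has norm at most `c`, so Euclidean speed is at most `c` times `G`-speed. -/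
lemma norm_path_sub_le {c : ℝ} (hK : ∀ x : 𝔼, (RKHS.kernel V x x).IsInvertible)
    (hV : EmbedsInC20 V) (hc0 : 0 ≤ c) (hc : ∀ (u : V) (x : 𝔼), ‖u x‖ ≤ c * ‖u‖)
    {γ γ' : ℝ → 𝔼} {a b t : ℝ}
    (hγ : ∀ t ∈ Icc a b, HasDerivWithinAt γ (γ' t) (Icc a b) t)
    (hγ' : ContinuousOn γ' (Icc a b)) (ht : t ∈ Icc a b) :
    ‖γ t - γ a‖ ≤ c * ∫ t in a..b, ‖minLift V (γ t) (γ' t)‖ := by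
  have hγc : ContinuousOn γ (Icc a b) := fun t ht => (hγ t ht).continuousWithinAt
  have hN := continuousOn_norm_minLift hV hK hγc hγ'
  have hab := ht.1.trans ht.2
  have hsub : Icc a t ⊆ Icc a b := Icc_subset_Icc_right ht.2
  rw [← integral_eq_sub_of_hasDerivWithinAt_Icc hγ hγ' le_rfl ht.1 ht.2]
  calc ‖∫ r in a..t, γ' r‖ ≤ ∫ r in a..t, c * ‖minLift V (γ r) (γ' r)‖ := by
        refine intervalIntegral.norm_integral_le_of_norm_le ht.1
          (ae_of_all _ fun r _ => norm_le_mul_norm_minLift (hK _) hc _)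
          (((hN.mono hsub).intervalIntegrable_of_Icc ht.1).const_mul c)
    _ = c * ∫ r in a..t, ‖minLift V (γ r) (γ' r)‖ := intervalIntegral.integral_const_mul _ _
    _ ≤ _ := by
        gcongr
        exact intervalIntegral.integral_mono_interval le_rfl ht.1 ht.2
          (ae_of_all _ fun _ => norm_nonneg _) (hN.intervalIntegrable_of_Icc hab)

/-- Makes sets of bounded kernel distance bounded in `ℝⁿ`; this stands in for completeness in the
existence of geodesics. -/
lemma norm_sub_le_mul_kernelDist (hV : EmbedsInC20 V)
    (hK : ∀ x : 𝔼, (RKHS.kernel V x x).IsInvertible) {c : ℝ} (hc0 : 0 ≤ c)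
    (hc : ∀ (u : V) (x : 𝔼), ‖u x‖ ≤ c * ‖u‖) (x y : 𝔼) :
    ‖x - y‖ ≤ c * kernelDist V x y := by
  have key : ∀ r, kernelDist V x y < r → ‖x - y‖ ≤ c * r := by
    intro r hr
    obtain ⟨γ, γ', hγ, hγ', rfl, rfl, hlt⟩ := exists_path_of_kernelDist_lt hV hK hr
    rw [norm_sub_rev]
    exact (norm_path_sub_le hK hV hc0 hc hγ hγ' (right_mem_Icc.2 zero_le_one)).trans (by gcongr)
  -- The infimum of lengths need not be attained, so `r` decreases to the distance.
  have hcont : Continuous fun r : ℝ => c * r := by fun_prop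
  exact ge_of_tendsto ((hcont.tendsto (kernelDist V x y)).mono_left
    nhdsWithin_le_nhds) ((eventually_mem_nhdsWithin (s := Ioi _)).mono fun r hr => key r hr)

/-- Lower bound of the distance by the norm at a nearby point. -/
lemma norm_minLift_sub_le_mul_kernelDist (hV : EmbedsInC20 V)
    (hK : ∀ x : 𝔼, (RKHS.kernel V x x).IsInvertible) {R B c : ℝ} (hB : 0 ≤ B)
    (hc0 : 0 ≤ c) (hc : ∀ (u : V) (x : 𝔼), ‖u x‖ ≤ c * ‖u‖)
    (h : ∀ y : 𝔼, ‖y‖ ≤ R → ∀ x h : 𝔼,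
      ‖minLift V y h‖ ≤ (1 + B * ‖y - x‖) * ‖minLift V x h‖)
    {p : 𝔼} (hp : ‖p‖ ≤ R) (y z : 𝔼) :
    ‖minLift V p (z - y)‖ ≤
      (1 + B * (‖p - y‖ + c * kernelDist V y z)) * kernelDist V y z := by
  have key : ∀ r, kernelDist V y z < r →
      ‖minLift V p (z - y)‖ ≤ (1 + B * (‖p - y‖ + c * r)) * r := by
    intro r hr
    have hr0 : 0 ≤ r := (kernelDist_nonneg y z).trans hr.le
    obtain ⟨γ, γ', hγ, hγ', rfl, rfl, hlt⟩ := exists_path_of_kernelDist_lt hV hK hr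
    have hγc : ContinuousOn γ (Icc 0 1) := fun t ht => (hγ t ht).continuousWithinAt
    rw [← integral_eq_sub_of_hasDerivWithinAt_Icc hγ hγ' le_rfl zero_le_one le_rfl,
      ← ContinuousLinearMap.intervalIntegral_comp_comm _
        (hγ'.intervalIntegrable_of_Icc zero_le_one)]
    calc ‖∫ t in (0 : ℝ)..1, minLift V p (γ' t)‖
        ≤ ∫ t in (0 : ℝ)..1, (1 + B * (‖p - γ 0‖ + c * r)) * ‖minLift V (γ t) (γ' t)‖ := by
          refine intervalIntegral.norm_integral_le_of_norm_le zero_le_one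
            (ae_of_all _ fun t ht => (h p hp (γ t) _).trans ?_)
            (((continuousOn_norm_minLift hV hK hγc hγ').intervalIntegrable_of_Icc
              zero_le_one).const_mul _)
          gcongr
          have h1 := norm_path_sub_le hK hV hc0 hc hγ hγ' (Ioc_subset_Icc_self ht)
          have h2 : ‖p - γ t‖ ≤ ‖p - γ 0‖ + ‖γ t - γ 0‖ := by
            rw [norm_sub_rev (γ t)]
            exact norm_sub_le_norm_sub_add_norm_sub _ _ _
          nlinarith
      _ = (1 + B * (‖p - γ 0‖ + c * r)) * ∫ t in (0 : ℝ)..1, ‖minLift V (γ t) (γ' t)‖ :=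
          intervalIntegral.integral_const_mul _ _
      _ ≤ _ := by gcongr
  have hcont : Continuous fun r : ℝ => (1 + B * (‖p - y‖ + c * r)) * r := by fun_prop
  exact ge_of_tendsto ((hcont.tendsto (kernelDist V y z)).mono_left
    nhdsWithin_le_nhds) ((eventually_mem_nhdsWithin (s := Ioi _)).mono fun r hr => key r hr)

end KernelDist

/-! ### Curves close to their chords are `C¹`. -/

section SlopeRegularity

variable {F : Type*} [NormedAddCommGroup F] [NormedSpace ℝ F]

lemma slope_sub_slope_eq (x : ℝ → F) {a b m : ℝ} (ham : a < m) (hmb : m ≤ b) :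
    slope x a m - slope x a b =
      (m - a)⁻¹ • (x m - x a - ((m - a) / (b - a)) • (x b - x a)) := by
  have h1 : m - a ≠ 0 := (sub_pos.2 ham).ne'
  have h2 : b - a ≠ 0 := (sub_pos.2 (ham.trans_le hmb)).ne'
  rw [slope_def_module, slope_def_module, smul_sub _ (x m - x a), smul_smul]
  congr 2
  field_simp

/-- If `m` lies in the right half of `[a, b]`, dividing the hypothesis by `m - a` costs only a
factor 2. Otherwise `b` is halved until this happens; the errors form a geometric series because
square roots of lengths shrink. -/
lemma norm_slope_sub_slope_le_of_left {x : ℝ → F} {l r C : ℝ} (hC : 0 ≤ C)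
    (H : ∀ a b m, l ≤ a → a < b → b ≤ r → m ∈ Icc a b →
      ‖x m - x a - ((m - a) / (b - a)) • (x b - x a)‖ ≤ C * ((b - a) * √(b - a)))
    {a b m : ℝ} (hl : l ≤ a) (hr : b ≤ r) (ham : a < m) (hmb : m ≤ b) :
    ‖slope x a m - slope x a b‖ ≤ 8 * C * √(b - a) := by
  have hhalf : ∀ a b m, l ≤ a → b ≤ r → a < m → m ≤ b → b - a ≤ 2 * (m - a) →
      ‖slope x a m - slope x a b‖ ≤ 2 * C * √(b - a) := by
    intro a b m hl hr ham hmb h2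
    have hpos : 0 < m - a := sub_pos.2 ham
    rw [slope_sub_slope_eq x ham hmb, norm_smul, norm_inv, Real.norm_of_nonneg hpos.le,
      inv_mul_le_iff₀ hpos]
    refine (H a b m hl (ham.trans_le hmb) hr ⟨ham.le, hmb⟩).trans ?_
    have : 0 ≤ C * √(b - a) := by positivity
    nlinarith
  have key : ∀ k : ℕ, ∀ b m, b ≤ r → a < m → m ≤ b → b - a ≤ 2 ^ k * (m - a) →
      ‖slope x a m - slope x a b‖ ≤ 8 * C * √(b - a) := by
    intro k
    induction k with
    | zero =>
      intro b m _ _ hmb h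
      obtain rfl : m = b := le_antisymm hmb (by simpa using h)
      simp only [sub_self, norm_zero]
      positivity
    | succ k ih =>
      intro b m hr ham hmb h
      have hC' : 0 ≤ C * √(b - a) := by positivity
      rcases le_or_gt (b - a) (2 * (m - a)) with h2 | h2
      · exact (hhalf a b m hl hr ham hmb h2).trans (by nlinarith)
      · have h3 := ih ((a + b) / 2) m (by linarith) ham (by linarith)
          (by rw [pow_succ] at h; linarith)
        have h4 := hhalf a b ((a + b) / 2) hl hr (by linarith) (by linarith) (by linarith)
        -- The factor `3 / 4` exceeds `√(1 / 2)`, and `8 * (3 / 4) + 2 = 8` closes the induction.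
        have h5 : √((a + b) / 2 - a) ≤ 3 / 4 * √(b - a) := by
          rw [Real.sqrt_le_left (by positivity), mul_pow, Real.sq_sqrt (by linarith)]
          linarith
        calc _ ≤ _ := norm_sub_le_norm_sub_add_norm_sub _ (slope x a ((a + b) / 2)) _
          _ ≤ 8 * C * (3 / 4 * √(b - a)) + 2 * C * √(b - a) :=
            add_le_add (h3.trans (by gcongr)) h4
          _ = _ := by ring
  have hpos : 0 < m - a := sub_pos.2 ham
  obtain ⟨k, hk⟩ := pow_unbounded_of_one_lt ((b - a) / (m - a)) (one_lt_two (α := ℝ))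
  exact key k b m hr ham hmb ((div_lt_iff₀ hpos).1 hk).le

/-- Pass from `[a, b]` to `[a, t]`, then to `[s, t]`; the second step has a common right end point
and is the first one for the reversed curve. -/
lemma norm_slope_sub_slope_le {x : ℝ → F} {l r C : ℝ} (hC : 0 ≤ C)
    (H : ∀ a b m, l ≤ a → a < b → b ≤ r → m ∈ Icc a b →
      ‖x m - x a - ((m - a) / (b - a)) • (x b - x a)‖ ≤ C * ((b - a) * √(b - a)))
    {a b s t : ℝ} (hl : l ≤ a) (hr : b ≤ r) (has : a ≤ s) (hst : s < t) (htb : t ≤ b) :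
    ‖slope x s t - slope x a b‖ ≤ 16 * C * √(b - a) := by
  have h1 := norm_slope_sub_slope_le_of_left hC H hl hr (has.trans_lt hst) htb
  have h2 := norm_slope_sub_slope_le_of_left (x := fun t => x (-t)) (l := -r) (r := -l) hC
    (fun a b m hl hab hr hm => by
      have := H (-b) (-a) (-m) (by linarith) (by linarith) (by linarith)
        ⟨by linarith [hm.2], by linarith [hm.1]⟩
      have hne : b - a ≠ 0 := (sub_pos.2 hab).ne'
      rw [show -a - -b = b - a by ring, show (-m - -b) / (b - a) = 1 - (m - a) / (b - a) by
        field_simp; ring] at this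
      convert this using 2
      module) (a := -t) (b := -a) (m := -s) (by linarith) (by linarith) (by linarith)
      (by linarith)
  have h3 : ∀ p q : ℝ, slope (fun t => x (-t)) (-p) (-q) = - slope x p q := fun p q => by
    rw [slope_def_module, slope_def_module, neg_neg, neg_neg, ← neg_smul, ← inv_neg]
    congr 2
    ring
  rw [h3, h3, slope_comm x t s, slope_comm x t a, ← norm_neg,
    show -(-slope x s t - -slope x a t) = slope x s t - slope x a t by abel] at h2
  have h4 : √(-a - -t) ≤ √(b - a) := Real.sqrt_le_sqrt (by linarith)
  calc _ ≤ _ := norm_sub_le_norm_sub_add_norm_sub _ (slope x a t) _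
    _ ≤ 8 * C * √(b - a) + 8 * C * √(b - a) := add_le_add (h2.trans (by gcongr)) h1
    _ = _ := by ring

/-- A curve whose deviation from its chords over intervals of length `τ` is `O(τ ^ (3 / 2))` is
continuously differentiable. -/
lemma exists_continuousOn_hasDerivWithinAt [CompleteSpace F] {x : ℝ → F} {l r C : ℝ} (hlr : l < r)
    (hC : 0 ≤ C)
    (H : ∀ a b m, l ≤ a → a < b → b ≤ r → m ∈ Icc a b →
      ‖x m - x a - ((m - a) / (b - a)) • (x b - x a)‖ ≤ C * ((b - a) * √(b - a))) :
    ∃ g : ℝ → F, ContinuousOn g (Icc l r) ∧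
      ∀ t ∈ Icc l r, HasDerivWithinAt x (g t) (Icc l r) t := by
  have hS : ∀ {a b s t : ℝ}, l ≤ a → b ≤ r → s ∈ Icc a b → t ∈ Icc a b → s ≠ t →
      ‖slope x s t - slope x a b‖ ≤ 16 * C * √(b - a) := by
    intro a b s t hl hr hs ht hst
    rcases hst.lt_or_gt with h | h
    · exact norm_slope_sub_slope_le hC H hl hr hs.1 h ht.2
    · rw [slope_comm]
      exact norm_slope_sub_slope_le hC H hl hr ht.1 h hs.2
  -- All slopes from `t` to points at distance less than `δ` are close to the slope of the whole
  -- window around `t`, so the slopes are Cauchy.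
  have hex : ∀ t ∈ Icc l r, ∃ g : F, HasDerivWithinAt x g (Icc l r) t := by
    intro t ht
    simp_rw [hasDerivWithinAt_iff_tendsto_slope]
    have hne : (𝓝[Icc l r \ {t}] t).NeBot := by
      have := (uniqueDiffOn_Icc hlr).uniqueDiffWithinAt ht
      exact accPt_principal_iff_nhdsWithin.1 this.accPt
    refine cauchy_map_iff_exists_tendsto.1 (Metric.cauchy_iff.2 ⟨inferInstance, fun ε hε => ?_⟩)
    have hlim : Tendsto (fun δ : ℝ => 2 * (16 * C * √(2 * δ))) (𝓝[>] 0) (𝓝 0) := by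
      have : Continuous (fun δ : ℝ => 2 * (16 * C * √(2 * δ))) := by fun_prop
      simpa using (this.tendsto 0).mono_left nhdsWithin_le_nhds
    obtain ⟨δ, hδε, hδ⟩ := ((hlim.eventually (gt_mem_nhds hε)).and
      (eventually_mem_nhdsWithin (s := Ioi (0 : ℝ)))).exists
    refine ⟨slope x t '' (Icc l r \ {t} ∩ Metric.ball t δ), image_mem_map
      (inter_mem self_mem_nhdsWithin (mem_nhdsWithin_of_mem_nhds (Metric.ball_mem_nhds t hδ))), ?_⟩
    have hδ0 : (0 : ℝ) < δ := hδ
    have hb : ∀ s ∈ Icc l r \ {t} ∩ Metric.ball t δ,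
        ‖slope x t s - slope x (max l (t - δ)) (min r (t + δ))‖ ≤ 16 * C * √(2 * δ) := by
      rintro s ⟨⟨hs, hst⟩, hsb⟩
      rw [Metric.mem_ball, Real.dist_eq, abs_lt] at hsb
      refine (hS (le_max_left _ _) (min_le_left _ _)
        ⟨max_le ht.1 (by linarith), le_min ht.2 (by linarith)⟩
        ⟨max_le hs.1 (by linarith), le_min hs.2 (by linarith)⟩ (Ne.symm hst)).trans ?_
      gcongr
      linarith [le_max_right l (t - δ), min_le_right r (t + δ)]
    rintro _ ⟨s, hs, rfl⟩ _ ⟨s', hs', rfl⟩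
    refine lt_of_le_of_lt ?_ hδε
    rw [dist_eq_norm]
    refine (norm_sub_le_norm_sub_add_norm_sub _
      (slope x (max l (t - δ)) (min r (t + δ))) _).trans ?_
    rw [norm_sub_rev _ (slope x t s')]
    linarith [hb s hs, hb s' hs']
  choose! g hg using hex
  refine ⟨g, ?_, hg⟩
  have hgs : ∀ {a b t : ℝ}, l ≤ a → b ≤ r → a < b → t ∈ Icc a b →
      ‖g t - slope x a b‖ ≤ 16 * C * √(b - a) := by
    intro a b t hl hr hab ht
    have h1 := (hg t ⟨hl.trans ht.1, ht.2.trans hr⟩).mono (Icc_subset_Icc hl hr)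
    rw [hasDerivWithinAt_iff_tendsto_slope] at h1
    have hne : (𝓝[Icc a b \ {t}] t).NeBot :=
      accPt_principal_iff_nhdsWithin.1 ((uniqueDiffOn_Icc hab).uniqueDiffWithinAt ht).accPt
    refine le_of_tendsto (h1.sub_const (slope x a b)).norm ?_
    filter_upwards [self_mem_nhdsWithin] with s hs
    exact hS hl hr ht hs.1 (Ne.symm hs.2)
  -- Both derivatives are close to the slope between `s` and `t`, so `g` is Hölder of exponent 1/2.
  have hgg : ∀ s ∈ Icc l r, ∀ t ∈ Icc l r, ‖g s - g t‖ ≤ 2 * (16 * C * √|s - t|) := by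
    have aux : ∀ s ∈ Icc l r, ∀ t ∈ Icc l r, s < t → ‖g s - g t‖ ≤ 2 * (16 * C * √|s - t|) := by
      intro s hs t ht hst
      have h1 := hgs hs.1 ht.2 hst (left_mem_Icc.2 hst.le)
      have h2 := hgs hs.1 ht.2 hst (right_mem_Icc.2 hst.le)
      rw [norm_sub_rev] at h2
      rw [abs_sub_comm, abs_of_pos (sub_pos.2 hst)]
      linarith [norm_sub_le_norm_sub_add_norm_sub (g s) (slope x s t) (g t)]
    intro s hs t ht
    rcases lt_trichotomy s t with h | rfl | h
    · exact aux s hs t ht h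
    · simp
    · rw [norm_sub_rev, abs_sub_comm]
      exact aux t ht s hs h
  intro t ht
  rw [ContinuousWithinAt, tendsto_iff_norm_sub_tendsto_zero]
  have hlim : Tendsto (fun s : ℝ => 2 * (16 * C * √|s - t|)) (𝓝[Icc l r] t) (𝓝 0) := by
    have : Continuous (fun s : ℝ => 2 * (16 * C * √|s - t|)) := by fun_prop
    simpa using (this.tendsto t).mono_left nhdsWithin_le_nhds
  exact squeeze_zero' (Eventually.of_forall fun _ => norm_nonneg _)
    (eventually_mem_nhdsWithin.mono fun s hs => hgg s hs t ht) hlim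

end SlopeRegularity

/-! ### Regularity and existence of minimizing geodesics. -/

section MinimizerRegularity

variable {n : ℕ} {V : Type*} [NormedAddCommGroup V] [InnerProductSpace ℝ V] [CompleteSpace V]
  [RKHS ℝ V (EuclideanSpace ℝ (Fin n)) (EuclideanSpace ℝ (Fin n))]

local notation "𝔼" => EuclideanSpace ℝ (Fin n)

/-- Quantitative strict convexity of the norm of an inner product space. -/
lemma norm_sq_smul_sub_smul_le {H : Type*} [NormedAddCommGroup H] [InnerProductSpace ℝ H]
    {u w : H} {θ X K τ D : ℝ} (hθ : θ ∈ Icc (0 : ℝ) 1) (hτ : 0 ≤ τ) (hτ1 : τ ≤ 1) (hK : 0 ≤ K)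
    (hD : 0 ≤ D) (hX : X = 1 + K * τ) (hu : ‖u‖ ≤ X * (D * (θ * τ)))
    (hw : ‖w‖ ≤ X * (D * ((1 - θ) * τ))) (huw : D * τ ≤ X * ‖u + w‖) :
    ‖(1 - θ) • u - θ • w‖ ^ 2 ≤ (K * (2 + K) * ((1 + K) ^ 2 + 1) * D ^ 2) * τ ^ 3 := by
  obtain ⟨h0, h1⟩ := hθ
  have h1' : 0 ≤ 1 - θ := sub_nonneg.2 h1
  have hX1 : 1 ≤ X := by rw [hX]; nlinarith
  have hX2 : X ≤ 1 + K := by rw [hX]; nlinarith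
  -- This identity is exact, so the deviation is governed by how nearly `u` and `w` saturate the
  -- triangle inequality.
  have hid : ‖(1 - θ) • u - θ • w‖ ^ 2 =
      (1 - θ) * ‖u‖ ^ 2 + θ * ‖w‖ ^ 2 - θ * (1 - θ) * ‖u + w‖ ^ 2 := by
    rw [norm_sub_sq_real, norm_add_sq_real, norm_smul, norm_smul, inner_smul_left,
      inner_smul_right, Real.norm_of_nonneg h0, Real.norm_of_nonneg h1']
    simp only [conj_trivial]
    ring
  have hu2 : ‖u‖ ^ 2 ≤ (X * (D * (θ * τ))) ^ 2 := by gcongr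
  have hw2 : ‖w‖ ^ 2 ≤ (X * (D * ((1 - θ) * τ))) ^ 2 := by gcongr
  have huw2 : (D * τ) ^ 2 ≤ (X * ‖u + w‖) ^ 2 := by gcongr
  set N := ‖u + w‖ ^ 2 with hN
  have hXp : 1 ≤ X ^ 2 := one_le_pow₀ hX1
  have hq : 0 ≤ θ * (1 - θ) := mul_nonneg h0 h1'
  have hq1 : θ * (1 - θ) ≤ 1 := by nlinarith
  have hDt : 0 ≤ (D * τ) ^ 2 := sq_nonneg _
  have hA : (1 - θ) * ‖u‖ ^ 2 + θ * ‖w‖ ^ 2 ≤ θ * (1 - θ) * (X ^ 2 * (D * τ) ^ 2) := by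
    calc _ ≤ (1 - θ) * (X * (D * (θ * τ))) ^ 2 + θ * (X * (D * ((1 - θ) * τ))) ^ 2 := by gcongr
      _ = _ := by ring
  have hE : X ^ 4 - 1 ≤ K * (2 + K) * ((1 + K) ^ 2 + 1) * τ := by
    have e1 : X ^ 4 - 1 = (X - 1) * ((X + 1) * (X ^ 2 + 1)) := by ring
    have e2 : (X + 1) * (X ^ 2 + 1) ≤ (2 + K) * ((1 + K) ^ 2 + 1) :=
      mul_le_mul (by linarith) (by gcongr) (by positivity) (by positivity)
    rw [e1, show X - 1 = K * τ by rw [hX]; ring]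
    calc _ ≤ K * τ * ((2 + K) * ((1 + K) ^ 2 + 1)) := by gcongr
      _ = _ := by ring
  -- When the left side is nonnegative it grows under multiplication by `X ^ 2`, after which `X ^ 2
  -- * N ≥ (D * τ) ^ 2` applies.
  have hB : X ^ 2 * (D * τ) ^ 2 - N ≤ (X ^ 4 - 1) * (D * τ) ^ 2 := by
    have : (D * τ) ^ 2 ≤ X ^ 2 * N := by rw [hN, ← mul_pow]; exact huw2
    have hN0 : 0 ≤ X ^ 2 * N := by positivity
    rcases le_or_gt N (X ^ 2 * (D * τ) ^ 2) with h | h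
    · have : X ^ 2 * (D * τ) ^ 2 - N ≤ X ^ 2 * (X ^ 2 * (D * τ) ^ 2 - N) := by nlinarith
      nlinarith
    · have h4 : 1 ≤ X ^ 4 := one_le_pow₀ hX1
      nlinarith
  have hX4 : 0 ≤ X ^ 4 - 1 := sub_nonneg.2 (one_le_pow₀ hX1)
  rw [hid]
  calc _ ≤ θ * (1 - θ) * (X ^ 2 * (D * τ) ^ 2 - N) := by linarith
    _ ≤ θ * (1 - θ) * ((X ^ 4 - 1) * (D * τ) ^ 2) := by gcongr
    _ ≤ 1 * ((X ^ 4 - 1) * (D * τ) ^ 2) := by gcongr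
    _ ≤ 1 * ((K * (2 + K) * ((1 + K) ^ 2 + 1) * τ) * (D * τ) ^ 2) := by gcongr
    _ = _ := by ring

/-- A curve whose kernel distances are proportional to the differences of the parameters satisfies
the two sided comparison with the norms on tangent spaces. -/
lemma exists_norm_minLift_comparison (hV : EmbedsInC20 V)
    (hK : ∀ x : 𝔼, (RKHS.kernel V x x).IsInvertible) {x : ℝ → 𝔼} {D : ℝ} (hD : 0 ≤ D)
    (hx : ∀ s ∈ Icc (0 : ℝ) 1, ∀ t ∈ Icc (0 : ℝ) 1, kernelDist V (x s) (x t) = D * |t - s|) :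
    ∃ K : ℝ, 0 ≤ K ∧
      (∀ s ∈ Icc (0 : ℝ) 1, ∀ t ∈ Icc (0 : ℝ) 1,
        D * |t - s| ≤ (1 + K * |t - s|) * ‖minLift V (x s) (x t - x s)‖) ∧
      ∀ p ∈ Icc (0 : ℝ) 1, ∀ s ∈ Icc (0 : ℝ) 1, ∀ t ∈ Icc (0 : ℝ) 1,
        ‖minLift V (x p) (x t - x s)‖ ≤
          (1 + K * (|p - s| + |t - s|)) * (D * |t - s|) := by
  obtain ⟨c, hc0, hc, -⟩ := hV.exists_bound
  have hdist : ∀ s ∈ Icc (0 : ℝ) 1, ∀ t ∈ Icc (0 : ℝ) 1, ‖x t - x s‖ ≤ c * (D * |t - s|) :=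
    fun s hs t ht => by
      rw [← hx s hs t ht, norm_sub_rev]
      exact norm_sub_le_mul_kernelDist hV hK hc0.le hc _ _
  have hR : ∀ s ∈ Icc (0 : ℝ) 1, ‖x s‖ ≤ ‖x 0‖ + c * D := fun s hs => by
    have h1 := hdist 0 (left_mem_Icc.2 zero_le_one) s hs
    have h2 : c * (D * |s - 0|) ≤ c * D := by
      rw [sub_zero, abs_of_nonneg hs.1]
      exact mul_le_mul_of_nonneg_left (mul_le_of_le_one_right hD hs.2) hc0.le
    linarith [norm_le_norm_add_norm_sub' (x s) (x 0)]
  obtain ⟨B, hB, hBx⟩ := exists_norm_minLift_le_mul hV hK (‖x 0‖ + c * D)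
  refine ⟨B * (c * D), by positivity, fun s hs t ht => ?_, fun p hp s hs t ht => ?_⟩
  · rw [← hx s hs t ht]
    refine (kernelDist_le_mul_norm_minLift hV hK hB.le hBx (hR s hs) (hR t ht)).trans ?_
    have : B * ‖x t - x s‖ ≤ B * (c * D) * |t - s| := by
      rw [mul_assoc]
      exact mul_le_mul_of_nonneg_left ((hdist s hs t ht).trans_eq (by ring)) hB.le
    gcongr
  · have := norm_minLift_sub_le_mul_kernelDist hV hK hB.le hc0.le hc hBx (hR p hp) (x s) (x t)
    rw [hx s hs t ht] at this
    refine this.trans ?_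
    have h3 := hdist s hs p hp
    have : B * (‖x p - x s‖ + c * (D * |t - s|)) ≤ B * (c * D) * (|p - s| + |t - s|) := by
      rw [mul_assoc]
      exact mul_le_mul_of_nonneg_left (by linarith) hB.le
    gcongr

/-- In the tangent norm frozen at `x a`, the two parts of a chord over `[a, b]` have nearly the
lengths `D * (m - a)` and `D * (b - m)`, and their sum nearly `D * (b - a)`. Strict convexity makes
them nearly proportional, with a squared defect cubic in `b - a`. Letting the chords shrink to a
point also yields the speed `D`. -/
lemma exists_deriv_of_kernelDist_eq (hV : EmbedsInC20 V)
    (hK : ∀ x : 𝔼, (RKHS.kernel V x x).IsInvertible) {x : ℝ → 𝔼} {D : ℝ} (hD : 0 ≤ D)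
    (hx : ∀ s ∈ Icc (0 : ℝ) 1, ∀ t ∈ Icc (0 : ℝ) 1, kernelDist V (x s) (x t) = D * |t - s|) :
    ∃ g : ℝ → 𝔼, ContinuousOn g (Icc 0 1) ∧
      (∀ t ∈ Icc (0 : ℝ) 1, HasDerivWithinAt x (g t) (Icc 0 1) t) ∧
      ∀ t ∈ Icc (0 : ℝ) 1, ‖minLift V (x t) (g t)‖ = D := by
  obtain ⟨c, hc0, hc, -⟩ := hV.exists_bound
  obtain ⟨K, hK0, hlow, hup⟩ := exists_norm_minLift_comparison hV hK hD hx
  set M := K * (2 + K) * ((1 + K) ^ 2 + 1) * D ^ 2 with hM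
  have hM0 : 0 ≤ M := by positivity
  -- `√M` bounds the deviation in the tangent norm and `c` converts it to the Euclidean norm.
  obtain ⟨g, hgc, hg⟩ := exists_continuousOn_hasDerivWithinAt (x := x) (l := 0) (r := 1)
    (C := c * √M) one_pos (by positivity) (by
    intro a b m ha hab hb hm
    have hab0 : 0 < b - a := sub_pos.2 hab
    set θ := (m - a) / (b - a) with hθ
    have hθm : θ * (b - a) = m - a := div_mul_cancel₀ _ hab0.ne'
    have hθI : θ ∈ Icc (0 : ℝ) 1 := ⟨div_nonneg (sub_nonneg.2 hm.1) hab0.le,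
      (div_le_one hab0).2 (by linarith [hm.2])⟩
    have haI : a ∈ Icc (0 : ℝ) 1 := ⟨ha, hab.le.trans hb⟩
    have hbI : b ∈ Icc (0 : ℝ) 1 := ⟨ha.trans hab.le, hb⟩
    have hmI : m ∈ Icc (0 : ℝ) 1 := ⟨ha.trans hm.1, hm.2.trans hb⟩
    -- The base point stays at `a`; since `(m - a) + (b - m) = b - a`, the factor `1 + K * (b - a)`
    -- serves for all three estimates.
    have h1 := hup a haI a haI m hmI
    have h2 := hup a haI m hmI b hbI
    have h3 := hlow a haI b hbI
    rw [abs_sub_comm a m, abs_of_nonneg (sub_nonneg.2 hm.1)] at h2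
    rw [abs_of_nonneg (sub_nonneg.2 hm.1)] at h1
    rw [abs_of_nonneg (sub_nonneg.2 hm.2)] at h2
    rw [abs_of_pos hab0] at h3
    set L := minLift V (x a)
    have key := norm_sq_smul_sub_smul_le (u := L (x m - x a)) (w := L (x b - x m))
      (X := 1 + K * (b - a)) (τ := b - a) hθI hab0.le (by linarith) hK0 hD rfl
      (by
        rw [hθm]
        refine h1.trans ?_
        have := hm.1
        have := hm.2
        rw [sub_self, abs_zero, zero_add]
        have : 0 ≤ m - a := by linarith
        gcongr)
      (by
        rw [show (1 - θ) * (b - a) = b - m by linear_combination - hθm]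
        refine h2.trans_eq ?_
        ring)
      (by
        rw [← map_add]
        simpa using h3)
    have e : (1 - θ) • L (x m - x a) - θ • L (x b - x m) =
        L (x m - x a - θ • (x b - x a)) := by
      simp only [map_sub, map_smul]
      module
    rw [e] at key
    have h4 : ‖L (x m - x a - θ • (x b - x a))‖ ≤ √M * ((b - a) * √(b - a)) := by
      refine (sq_le_sq₀ (norm_nonneg _) (by positivity)).1 (key.trans_eq ?_)
      rw [mul_pow, mul_pow, Real.sq_sqrt hM0, Real.sq_sqrt hab0.le]
      ring
    refine (norm_le_mul_norm_minLift (hK (x a)) hc _).trans ?_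
    rw [mul_assoc]
    gcongr)
  refine ⟨g, hgc, hg, fun t ht => ?_⟩
  have hne : (𝓝[Icc 0 1 \ {t}] t).NeBot := accPt_principal_iff_nhdsWithin.1
    ((uniqueDiffOn_Icc (zero_lt_one' ℝ)).uniqueDiffWithinAt ht).accPt
  have hlim : Tendsto (fun s => ‖minLift V (x t) (slope x t s)‖) (𝓝[Icc 0 1 \ {t}] t)
      (𝓝 ‖minLift V (x t) (g t)‖) :=
    (((minLift V (x t)).continuous.tendsto _).comp (hasDerivWithinAt_iff_tendsto_slope.1 (hg t ht))).norm
  have hfac : Tendsto (fun s => 1 + K * |s - t|) (𝓝[Icc 0 1 \ {t}] t) (𝓝 1) := by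
    have : Continuous (fun s : ℝ => 1 + K * |s - t|) := by fun_prop
    simpa using (this.tendsto t).mono_left nhdsWithin_le_nhds
  have hslope : ∀ s, s ≠ t →
      ‖minLift V (x t) (x s - x t)‖ = |s - t| * ‖minLift V (x t) (slope x t s)‖ := fun s hs => by
    rw [← Real.norm_eq_abs, ← norm_smul, ← map_smul, slope_def_module, smul_smul,
      mul_inv_cancel₀ (sub_ne_zero.2 hs), one_smul]
  apply le_antisymm
  · have h := hfac.mul_const D
    rw [one_mul] at h
    refine le_of_tendsto_of_tendsto hlim h ?_
    filter_upwards [self_mem_nhdsWithin] with s hs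
    have hpos : 0 < |s - t| := abs_pos.2 (sub_ne_zero.2 hs.2)
    have := hup t ht t ht s hs.1
    rw [hslope s hs.2, sub_self, abs_zero, zero_add] at this
    exact le_of_mul_le_mul_left (this.trans_eq (by ring)) hpos
  · have h := hfac.mul hlim
    rw [one_mul] at h
    refine ge_of_tendsto h ?_
    filter_upwards [self_mem_nhdsWithin] with s hs
    have hpos : 0 < |s - t| := abs_pos.2 (sub_ne_zero.2 hs.2)
    have := hlow t ht s hs.1
    rw [hslope s hs.2] at this
    exact le_of_mul_le_mul_left (by linarith) hpos

/-- A curve joining `x₀` to `x₁` that is Lipschitz with the distance of `x₀` and `x₁` as constant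
is a geodesic. -/
theorem isKernelGeodesic_of_kernelDist_le (hV : EmbedsInC20 V)
    (hK : ∀ x : 𝔼, (RKHS.kernel V x x).IsInvertible) {x₀ x₁ : 𝔼} {x : ℝ → 𝔼}
    (h0 : x 0 = x₀) (h1 : x 1 = x₁)
    (hx : ∀ s ∈ Icc (0 : ℝ) 1, ∀ t ∈ Icc (0 : ℝ) 1, s ≤ t →
      kernelDist V (x s) (x t) ≤ kernelDist V x₀ x₁ * (t - s)) :
    IsKernelGeodesic V x₀ x₁ x := by
  have hI0 : (0 : ℝ) ∈ Icc (0 : ℝ) 1 := left_mem_Icc.2 zero_le_one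
  have hI1 : (1 : ℝ) ∈ Icc (0 : ℝ) 1 := right_mem_Icc.2 zero_le_one
  -- The bounds on `[0, s]`, `[s, t]` and `[t, 1]` add up to the full distance, so the triangle
  -- inequality leaves no slack.
  have heq : ∀ s ∈ Icc (0 : ℝ) 1, ∀ t ∈ Icc (0 : ℝ) 1, s ≤ t →
      kernelDist V (x s) (x t) = kernelDist V x₀ x₁ * (t - s) := by
    intro s hs t ht hst
    refine le_antisymm (hx s hs t ht hst) ?_
    have e1 := hx 0 hI0 s hs hs.1
    have e2 := hx t ht 1 hI1 ht.2
    rw [h0] at e1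
    rw [h1] at e2
    have e3 := kernelDist_triangle hV hK x₀ (x s) x₁
    have e4 := kernelDist_triangle hV hK (x s) (x t) x₁
    linarith
  obtain ⟨g, hgc, hg, hD⟩ := exists_deriv_of_kernelDist_eq hV hK (x := x)
    (kernelDist_nonneg x₀ x₁) (fun s hs t ht => by
      rcases le_total s t with h | h
      · rw [heq s hs t ht h, abs_of_nonneg (sub_nonneg.2 h)]
      · rw [kernelDist_comm hK, heq t ht s hs h, abs_sub_comm, abs_of_nonneg (sub_nonneg.2 h)])
  refine ⟨contDiffOn_one_Icc_of_hasDerivWithinAt one_pos hg hgc, h0, h1, fun t ht => ?_⟩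
  rw [kernelSpeed_eq (hK _), (hg t ht).derivWithin (uniqueDiffOn_Icc one_pos t ht),
    ← ofReal_norm, hD t ht, kernelDist, ENNReal.ofReal_toReal (kernelEDist_ne_top hV hK _ _)]

lemma tendsto_kernelDist (hV : EmbedsInC20 V)
    (hK : ∀ x : 𝔼, (RKHS.kernel V x x).IsInvertible) (y : 𝔼) :
    Tendsto (fun z => kernelDist V y z) (𝓝 y) (𝓝 0) := by
  obtain ⟨B, hB, hBx⟩ := exists_norm_minLift_le_mul hV hK (‖y‖ + 1)
  have hlim : Tendsto (fun z => (1 + B * ‖z - y‖) * ‖minLift V y (z - y)‖) (𝓝 y) (𝓝 0) := by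
    have : Continuous (fun z => (1 + B * ‖z - y‖) * ‖minLift V y (z - y)‖) := by fun_prop
    simpa using this.tendsto y
  refine squeeze_zero' (Eventually.of_forall fun _ => kernelDist_nonneg _ _) ?_ hlim
  filter_upwards [Metric.ball_mem_nhds y one_pos] with z hz
  refine kernelDist_le_mul_norm_minLift hV hK hB.le hBx (by linarith) ?_
  rw [Metric.mem_ball, dist_eq_norm] at hz
  linarith [norm_le_norm_add_norm_sub' z y]

/-- Hopf-Rinow for the kernel metric. -/
theorem exists_isKernelGeodesic (hV : EmbedsInC20 V)
    (hK : ∀ x : 𝔼, (RKHS.kernel V x x).IsInvertible) (x₀ x₁ : 𝔼) :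
    ∃ x : ℝ → 𝔼, IsKernelGeodesic V x₀ x₁ x := by
  set D := kernelDist V x₀ x₁ with hD
  have hD0 : 0 ≤ D := kernelDist_nonneg _ _
  have happrox : ∀ k : ℕ, ∃ x : ℝ → 𝔼, x 0 = x₀ ∧ x 1 = x₁ ∧
      ∀ s ∈ Icc (0 : ℝ) 1, ∀ t ∈ Icc (0 : ℝ) 1, s ≤ t →
        kernelDist V (x s) (x t) ≤ (D + 1 / ((k : ℝ) + 1)) * (t - s) := by
    intro k
    obtain ⟨γ, γ', hγ, hγ', rfl, rfl, hlt⟩ := exists_path_of_kernelDist_lt hV hK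
      (show kernelDist V x₀ x₁ < D + 1 / ((k : ℝ) + 1) by
        rw [hD]; exact lt_add_of_pos_right _ (by positivity))
    have hγc : ContinuousOn γ (Icc 0 1) := fun t ht => (hγ t ht).continuousWithinAt
    set N : ℝ → ℝ := fun t => ‖minLift V (γ t) (γ' t)‖ with hN
    have hNc : ContinuousOn N (Icc 0 1) := continuousOn_norm_minLift hV hK hγc hγ'
    have hNi : ∀ a ∈ Icc (0 : ℝ) 1, ∀ b ∈ Icc (0 : ℝ) 1, IntervalIntegrable N volume a b :=
      fun a ha b hb => (hNc.mono (uIcc_subset_Icc ha hb)).intervalIntegrable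
    have hI0 : (0 : ℝ) ∈ Icc (0 : ℝ) 1 := left_mem_Icc.2 zero_le_one
    have hI1 : (1 : ℝ) ∈ Icc (0 : ℝ) 1 := right_mem_Icc.2 zero_le_one
    set ℓ : ℝ → ℝ := fun t => ∫ r in (0 : ℝ)..t, N r with hℓ
    have hℓc : ContinuousOn ℓ (Icc 0 1) := by
      have := intervalIntegral.continuousOn_primitive_interval (μ := volume) (f := N) (a := 0)
        (b := 1) (by rw [uIcc_of_le zero_le_one]; exact hNc.integrableOn_Icc)
      rwa [uIcc_of_le zero_le_one] at this
    set L := ℓ 1 with hL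
    have hL0 : 0 ≤ L := intervalIntegral.integral_nonneg zero_le_one fun _ _ => norm_nonneg _
    have hℓ0 : ℓ 0 = 0 := intervalIntegral.integral_same
    have hle : ∀ a ∈ Icc (0 : ℝ) 1, ∀ b ∈ Icc (0 : ℝ) 1, a ≤ b →
        kernelDist V (γ a) (γ b) ≤ ℓ b - ℓ a := by
      intro a ha b hb hab
      have hsub : Icc a b ⊆ Icc 0 1 := Icc_subset_Icc ha.1 hb.2
      rw [intervalIntegral.integral_interval_sub_left (hNi 0 hI0 b hb) (hNi 0 hI0 a ha)]
      exact kernelDist_le_integral hV hK hab (fun t ht => (hγ t (hsub ht)).mono hsub)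
        (hγ'.mono hsub)
    -- Reparametrization proportional to arc length. The length `ℓ` may be constant on intervals, so
    -- the preimages of the end values are prescribed.
    have hτ : ∀ s ∈ Icc (0 : ℝ) 1, ∃ τ ∈ Icc (0 : ℝ) 1, ℓ τ = s * L ∧
        (s = 0 → τ = 0) ∧ (s = 1 → τ = 1) := by
      intro s hs
      by_cases hs0 : s = 0
      · exact ⟨0, hI0, by rw [hs0, zero_mul, hℓ0], fun _ => rfl,
          fun h => absurd (h.symm.trans hs0) one_ne_zero⟩
      by_cases hs1 : s = 1
      · exact ⟨1, hI1, by rw [hs1, one_mul], fun h => absurd h hs0, fun _ => rfl⟩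
      obtain ⟨τ, hτ, h⟩ := intermediate_value_Icc zero_le_one hℓc
        (show s * L ∈ Icc (ℓ 0) (ℓ 1) from
          ⟨by rw [hℓ0]; exact mul_nonneg hs.1 hL0, mul_le_of_le_one_left hL0 hs.2⟩)
      exact ⟨τ, hτ, h, fun h => absurd h hs0, fun h => absurd h hs1⟩
    choose! τ hτI hτℓ hτ0 hτ1 using hτ
    refine ⟨fun s => γ (τ s), by simp only [hτ0 0 hI0 rfl], by simp only [hτ1 1 hI1 rfl],
      fun s hs t ht hst => ?_⟩
    have hL' : L * (t - s) ≤ (D + 1 / ((k : ℝ) + 1)) * (t - s) :=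
      mul_le_mul_of_nonneg_right hlt.le (sub_nonneg.2 hst)
    refine le_trans ?_ hL'
    rcases le_total (τ s) (τ t) with h | h
    · refine (hle _ (hτI s hs) _ (hτI t ht) h).trans_eq ?_
      rw [hτℓ s hs, hτℓ t ht]
      ring
    -- The chosen `τ` need not be monotone; in the reversed case the bound `(s - t) * L` is
    -- nonpositive.
    · rw [kernelDist_comm hK]
      refine (hle _ (hτI t ht) _ (hτI s hs) h).trans ?_
      rw [hτℓ s hs, hτℓ t ht]
      nlinarith [mul_nonneg hL0 (sub_nonneg.2 hst)]
  choose X hX0 hX1 hX using happrox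
  obtain ⟨c, hc0, hc, -⟩ := hV.exists_bound
  have hbound : ∀ k, ∀ t ∈ Icc (0 : ℝ) 1, X k t ∈ Metric.closedBall x₀ (c * (D + 1)) := by
    intro k t ht
    rw [Metric.mem_closedBall, dist_eq_norm, norm_sub_rev, ← hX0 k]
    refine (norm_sub_le_mul_kernelDist hV hK hc0.le hc _ _).trans ?_
    gcongr
    refine (hX k 0 (left_mem_Icc.2 zero_le_one) t ht ht.1).trans ?_
    have : 1 / ((k : ℝ) + 1) ≤ 1 := by
      rw [div_le_one (by positivity)]
      linarith [(k.cast_nonneg : (0 : ℝ) ≤ k)]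
    have h1 : 0 ≤ D + 1 / ((k : ℝ) + 1) := by positivity
    rw [sub_zero]
    exact (mul_le_of_le_one_right h1 ht.2).trans (by linarith)
  -- Pointwise limits along an ultrafilter suffice, since the Lipschitz bound passes to the limit
  -- and already implies regularity.
  have hlim : ∀ t ∈ Icc (0 : ℝ) 1, ∃ z : 𝔼,
      Tendsto (fun k => X k t) (hyperfilter ℕ : Filter ℕ) (𝓝 z) := by
    intro t ht
    obtain ⟨z, -, hz⟩ := (isCompact_closedBall x₀ (c * (D + 1))).ultrafilter_le_nhds
      ((hyperfilter ℕ).map fun k => X k t)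
      (le_principal_iff.2 (Ultrafilter.mem_map.2 (Eventually.of_forall fun k => hbound k t ht)))
    exact ⟨z, hz⟩
  choose! x hxlim using hlim
  have hI0 : (0 : ℝ) ∈ Icc (0 : ℝ) 1 := left_mem_Icc.2 zero_le_one
  have hI1 : (1 : ℝ) ∈ Icc (0 : ℝ) 1 := right_mem_Icc.2 zero_le_one
  refine ⟨x, isKernelGeodesic_of_kernelDist_le hV hK ?_ ?_ fun s hs t ht hst => ?_⟩
  · have := hxlim 0 hI0
    simp only [hX0] at this
    exact tendsto_nhds_unique this tendsto_const_nhds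
  · have := hxlim 1 hI1
    simp only [hX1] at this
    exact tendsto_nhds_unique this tendsto_const_nhds
  · have h1 := (tendsto_kernelDist hV hK (x s)).comp (hxlim s hs)
    have h2 := (tendsto_kernelDist hV hK (x t)).comp (hxlim t ht)
    have h3 : Tendsto (fun k : ℕ => (D + 1 / ((k : ℝ) + 1)) * (t - s))
        (hyperfilter ℕ : Filter ℕ) (𝓝 ((D + 0) * (t - s))) :=
      ((tendsto_one_div_add_atTop_nhds_zero_nat.mono_left
        Nat.hyperfilter_le_atTop).const_add D).mul_const _
    have h4 := (h1.add h3).add h2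
    rw [add_zero, zero_add, add_zero] at h4
    refine ge_of_tendsto h4 (Eventually.of_forall fun k => ?_)
    have e1 := kernelDist_triangle hV hK (x s) (X k s) (x t)
    have e2 := kernelDist_triangle hV hK (X k s) (X k t) (x t)
    rw [kernelDist_comm hK (X k t)] at e2
    simp only [Function.comp_apply]
    linarith [hX k s hs t ht hst]

end MinimizerRegularity

/-! ### Kernel distance along trajectories of `L²` controls. -/

section IntegralCurves

variable {n : ℕ} {V : Type*} [NormedAddCommGroup V] [InnerProductSpace ℝ V] [CompleteSpace V]
  [RKHS ℝ V (EuclideanSpace ℝ (Fin n)) (EuclideanSpace ℝ (Fin n))]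

local notation "𝔼" => EuclideanSpace ℝ (Fin n)

/-- The distance between two points of a trajectory of a time dependent field is at most the
integral of the norms of the field. -/
theorem kernelDist_le_integral_norm (hV : EmbedsInC20 V)
    (hK : ∀ x : 𝔼, (RKHS.kernel V x x).IsInvertible) {v : ℝ → V} {x : ℝ → 𝔼} {p : 𝔼}
    (hv : IntervalIntegrable (fun s => ‖v s‖) volume 0 1)
    (hvx : IntervalIntegrable (fun s => v s (x s)) volume 0 1)
    (hx : ∀ t ∈ Icc (0 : ℝ) 1, x t = p + ∫ s in (0 : ℝ)..t, v s (x s))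
    {s t : ℝ} (hs : s ∈ Icc (0 : ℝ) 1) (ht : t ∈ Icc (0 : ℝ) 1) (hst : s ≤ t) :
    kernelDist V (x s) (x t) ≤ ∫ r in s..t, ‖v r‖ := by
  have hI0 : (0 : ℝ) ∈ Icc (0 : ℝ) 1 := left_mem_Icc.2 zero_le_one
  have hvi : ∀ a ∈ Icc (0 : ℝ) 1, ∀ b ∈ Icc (0 : ℝ) 1,
      IntervalIntegrable (fun s => ‖v s‖) volume a b := fun a ha b hb =>
    hv.mono_set (by rw [uIcc_of_le (zero_le_one' ℝ)]; exact uIcc_subset_Icc ha hb)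
  have hvxi : ∀ a ∈ Icc (0 : ℝ) 1, ∀ b ∈ Icc (0 : ℝ) 1,
      IntervalIntegrable (fun s => v s (x s)) volume a b := fun a ha b hb =>
    hvx.mono_set (by rw [uIcc_of_le (zero_le_one' ℝ)]; exact uIcc_subset_Icc ha hb)
  have hxc : ContinuousOn x (Icc 0 1) := by
    have h := intervalIntegral.continuousOn_primitive_interval' hvx
      (by rw [uIcc_of_le (zero_le_one' ℝ)]; exact hI0)
    rw [uIcc_of_le (zero_le_one' ℝ)] at h
    exact (h.const_add p).congr hx
  obtain ⟨R, hR⟩ := isCompact_Icc.exists_bound_of_continuousOn hxc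
  obtain ⟨B, hB, hBx⟩ := exists_norm_minLift_le_mul hV hK R
  -- The trajectory need not be `C¹`, so it does not compete in the definition of the distance. On
  -- short steps it is replaced by segments: one factor `1 + ε` pays for freezing the tangent norm
  -- along the trajectory, the other along the segment.
  have key : ∀ ε : ℝ, 0 < ε → kernelDist V (x s) (x t) ≤ (1 + ε) ^ 2 * ∫ r in s..t, ‖v r‖ := by
    intro ε hε
    obtain ⟨δ, hδ, hδx⟩ := Metric.uniformContinuousOn_iff.1
      (isCompact_Icc.uniformContinuousOn_of_continuous hxc) (ε / B) (by positivity)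
    have hBε : ∀ a ∈ Icc (0 : ℝ) 1, ∀ b ∈ Icc (0 : ℝ) 1, |a - b| < δ →
        B * ‖x a - x b‖ ≤ ε := fun a ha b hb hab => by
      have := hδx a ha b hb (by rwa [Real.dist_eq])
      rw [dist_eq_norm, lt_div_iff₀ hB] at this
      linarith
    have hstep : ∀ a ∈ Icc (0 : ℝ) 1, ∀ b ∈ Icc (0 : ℝ) 1, a ≤ b → b - a < δ →
        kernelDist V (x a) (x b) ≤ (1 + ε) ^ 2 * ∫ r in a..b, ‖v r‖ := by
      intro a ha b hb hab hδ'
      have hint : x b - x a = ∫ r in a..b, v r (x r) := by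
        rw [hx a ha, hx b hb, add_sub_add_left_eq_sub,
          intervalIntegral.integral_interval_sub_left (hvxi 0 hI0 b hb) (hvxi 0 hI0 a ha)]
      have h2 : ‖minLift V (x a) (x b - x a)‖ ≤ ∫ r in a..b, (1 + ε) * ‖v r‖ := by
        rw [hint, ← ContinuousLinearMap.intervalIntegral_comp_comm _ (hvxi a ha b hb)]
        refine intervalIntegral.norm_integral_le_of_norm_le hab
          (ae_of_all _ fun r hr => ?_) ((hvi a ha b hb).const_mul _)
        refine (hBx _ (hR a ha) (x r) _).trans ?_
        gcongr
        · refine hBε a ha r ⟨ha.1.trans hr.1.le, hr.2.trans hb.2⟩ ?_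
          rw [abs_sub_comm, abs_of_pos (sub_pos.2 hr.1)]
          linarith [hr.2]
        · exact norm_minLift_le (hK _) _
      rw [intervalIntegral.integral_const_mul] at h2
      have h3 : B * ‖x b - x a‖ ≤ ε := hBε b hb a ha (by rwa [abs_of_nonneg (sub_nonneg.2 hab)])
      calc _ ≤ _ := kernelDist_le_mul_norm_minLift hV hK hB.le hBx (hR a ha) (hR b hb)
        _ ≤ (1 + ε) * ((1 + ε) * ∫ r in a..b, ‖v r‖) := by gcongr
        _ = _ := by ring
    obtain ⟨N, hN⟩ := exists_nat_gt ((t - s) / δ)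
    have hts : 0 ≤ t - s := sub_nonneg.2 hst
    have hN0 : 0 < (N : ℝ) := (div_nonneg hts hδ.le).trans_lt hN
    set h := (t - s) / N with hh
    have hh0 : 0 ≤ h := div_nonneg hts hN0.le
    have hNh : (N : ℝ) * h = t - s := by rw [hh]; field_simp
    have hhδ : h < δ := by
      rw [hh, div_lt_iff₀ hN0]
      rw [div_lt_iff₀ hδ] at hN
      linarith
    have hind : ∀ k : ℕ, k ≤ N → kernelDist V (x s) (x (s + k * h)) ≤
        (1 + ε) ^ 2 * ∫ r in s..(s + k * h), ‖v r‖ := by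
      have hmem : ∀ k : ℕ, k ≤ N → s + k * h ∈ Icc (0 : ℝ) 1 := fun k hk => by
        have h1 : (k : ℝ) * h ≤ N * h := by gcongr
        have h2 : 0 ≤ (k : ℝ) * h := by positivity
        exact ⟨by linarith [hs.1], by linarith [ht.2]⟩
      intro k
      induction k with
      | zero => intro _; simp [kernelDist_self hK]
      | succ k ih =>
        intro hk
        have hk' : k ≤ N := (Nat.le_succ k).trans hk
        have e1 := ih hk'
        have e2 := hstep _ (hmem k hk') _ (hmem (k + 1) hk)
          (by push_cast; linarith) (by push_cast; linarith)
        rw [← intervalIntegral.integral_add_adjacent_intervals (hvi _ hs _ (hmem k hk'))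
          (hvi _ (hmem k hk') _ (hmem (k + 1) hk)), mul_add]
        exact (kernelDist_triangle hV hK _ _ _).trans (add_le_add e1 e2)
    have := hind N le_rfl
    rwa [hNh, add_sub_cancel] at this
  have hlim : Tendsto (fun ε : ℝ => (1 + ε) ^ 2 * ∫ r in s..t, ‖v r‖) (𝓝[>] 0)
      (𝓝 (∫ r in s..t, ‖v r‖)) := by
    have : Continuous (fun ε : ℝ => (1 + ε) ^ 2 * ∫ r in s..t, ‖v r‖) := by fun_prop
    simpa using (this.tendsto 0).mono_left nhdsWithin_le_nhds
  exact ge_of_tendsto hlim ((eventually_mem_nhdsWithin (s := Ioi _)).mono fun ε hε => key ε hε)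

end IntegralCurves

/-! ### Flows of bounded Lipschitz fields. -/

section Flow

open scoped NNReal

variable {F : Type*} [NormedAddCommGroup F] [NormedSpace ℝ F]

/-- `α` solves the differential equation `α' = f t α` on `[0, T]`. -/
def IsODESolution (f : ℝ → F → F) (T : ℝ) (α : ℝ → F) : Prop :=
  ∀ t ∈ Icc 0 T, HasDerivWithinAt α (f t (α t)) (Icc 0 T) t

lemma IsODESolution.mono {f : ℝ → F → F} {S T : ℝ} {α : ℝ → F} (h : IsODESolution f T α)
    (hST : S ≤ T) : IsODESolution f S α := fun t ht =>
  (h t ⟨ht.1, ht.2.trans hST⟩).mono (Icc_subset_Icc_right hST)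

lemma IsODESolution.reverse {f : ℝ → F → F} {T : ℝ} {α : ℝ → F} (h : IsODESolution f T α) :
    IsODESolution (fun s y => -f (T - s) y) T (fun s => α (T - s)) := by
  intro t ht
  have h1 := h (T - t) ⟨by linarith [ht.2], by linarith [ht.1]⟩
  have h2 : HasDerivWithinAt (fun s => T - s) (-1) (Icc 0 T) t := by
    simpa using ((hasDerivAt_id t).const_sub T).hasDerivWithinAt
  have h3 := h1.scomp t h2 (fun s hs => ⟨by linarith [hs.2], by linarith [hs.1]⟩)
  rwa [neg_one_smul] at h3

lemma IsODESolution.dist_le {f : ℝ → F → F} {K : ℝ≥0} (hf : ∀ t, LipschitzWith K (f t))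
    {T : ℝ} (hT : 0 ≤ T) {α β : ℝ → F} (hα : IsODESolution f T α) (hβ : IsODESolution f T β) :
    dist (α T) (β T) ≤ dist (α 0) (β 0) * Real.exp (K * T) := by
  have hder : ∀ {α : ℝ → F}, IsODESolution f T α →
      ∀ t ∈ Ico 0 T, HasDerivWithinAt α (f t (α t)) (Ici t) t := fun h t ht =>
    (h t (Ico_subset_Icc_self ht)).mono_of_mem_nhdsWithin (Icc_mem_nhdsGE_of_mem ht)
  simpa using dist_le_of_trajectories_ODE hf (fun t ht => (hα t ht).continuousWithinAt)
    (hder hα) (fun t ht => (hβ t ht).continuousWithinAt) (hder hβ) le_rfl T (right_mem_Icc.2 hT)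

lemma IsODESolution.eq {f : ℝ → F → F} {K : ℝ≥0} (hf : ∀ t, LipschitzWith K (f t))
    {T : ℝ} (hT : 0 ≤ T) {α β : ℝ → F} (hα : IsODESolution f T α) (hβ : IsODESolution f T β)
    (h0 : α 0 = β 0) : α T = β T := by
  have := hα.dist_le hf hT hβ
  rw [h0, dist_self, zero_mul] at this
  exact dist_le_zero.1 this

variable [CompleteSpace F]

/-- Speed at most `L` keeps the solution in the ball of radius `L` for unit time, so Picard-Lindelöf
reaches time 1 without continuation. -/
lemma exists_isODESolution {f : ℝ → F → F} {K L : ℝ≥0} (hf : ∀ t, LipschitzWith K (f t))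
    (hb : ∀ t y, ‖f t y‖ ≤ L) (hc : ∀ y, Continuous fun t => f t y) (y : F) :
    ∃ α : ℝ → F, α 0 = y ∧ IsODESolution f 1 α := by
  have hPL : IsPicardLindelof f (tmin := 0) (tmax := 1) ⟨0, left_mem_Icc.2 zero_le_one⟩ y L 0 L K :=
    { lipschitzOnWith := fun t _ => (hf t).lipschitzOnWith
      continuousOn := fun z _ => (hc z).continuousOn
      norm_le := fun t _ z _ => hb t z
      mul_max_le := by simp }
  exact hPL.exists_eq_forall_mem_Icc_hasDerivWithinAt₀

/-- The flow of a bounded time dependent field that is continuous in time and uniformly Lipschitz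
in space. -/
theorem exists_homeomorph_isODESolution {f : ℝ → F → F} {K L : ℝ≥0}
    (hf : ∀ t, LipschitzWith K (f t)) (hb : ∀ t y, ‖f t y‖ ≤ L)
    (hc : ∀ y, Continuous fun t => f t y) :
    ∃ φ : ℝ → F ≃ₜ F, ∀ y, φ 0 y = y ∧ IsODESolution f 1 (fun t => φ t y) := by
  choose Φ hΦ0 hΦ using exists_isODESolution hf hb hc
  -- The inverse at time `T` is the time-`T` value of the equation run backwards from `T`;
  -- uniqueness makes the two maps inverse to each other.
  choose Ψ hΨ0 hΨ using fun T : ℝ => exists_isODESolution (f := fun s y => -f (T - s) y)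
    (K := K) (L := L) (fun t => (hf (T - t)).neg) (fun t y => by rw [norm_neg]; exact hb _ _)
    (fun y => ((hc y).comp (continuous_const.sub continuous_id)).neg)
  have hf' : ∀ T t, LipschitzWith K (fun y => -f (T - t) y) := fun T t => (hf (T - t)).neg
  have hleft : ∀ T ∈ Icc (0 : ℝ) 1, ∀ y, Ψ T (Φ y T) T = y := fun T hT y => by
    have h1 := ((hΦ y).mono hT.2).reverse
    have h2 := IsODESolution.eq (hf' T) hT.1 ((hΨ T (Φ y T)).mono hT.2) h1
      (by simp [hΨ0])
    rw [h2, sub_self, hΦ0]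
  have hright : ∀ T ∈ Icc (0 : ℝ) 1, ∀ y, Φ (Ψ T y T) T = y := fun T hT y => by
    have h1 := ((hΨ T y).mono hT.2).reverse
    simp only [sub_sub_cancel, neg_neg] at h1
    have h2 := IsODESolution.eq hf hT.1 ((hΦ (Ψ T y T)).mono hT.2) h1 (by simp [hΦ0])
    rw [h2, sub_self, hΨ0]
  have hΦc : ∀ T ∈ Icc (0 : ℝ) 1, Continuous fun y => Φ y T := fun T hT =>
    (LipschitzWith.of_dist_le_mul (K := ⟨Real.exp (K * T), (Real.exp_pos _).le⟩) fun y z => by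
      have := ((hΦ y).mono hT.2).dist_le hf hT.1 ((hΦ z).mono hT.2)
      rwa [hΦ0, hΦ0, mul_comm] at this).continuous
  have hΨc : ∀ T ∈ Icc (0 : ℝ) 1, Continuous fun y => Ψ T y T := fun T hT =>
    (LipschitzWith.of_dist_le_mul (K := ⟨Real.exp (K * T), (Real.exp_pos _).le⟩) fun y z => by
      have := ((hΨ T y).mono hT.2).dist_le (hf' T) hT.1 ((hΨ T z).mono hT.2)
      rwa [hΨ0, hΨ0, mul_comm] at this).continuous
  classical
  -- The identity is a default value outside `[0, 1]`, where nothing is asked of the flow.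
  let φ : ℝ → F ≃ₜ F := fun T => if hT : T ∈ Icc (0 : ℝ) 1 then
    { toFun := fun y => Φ y T
      invFun := fun y => Ψ T y T
      left_inv := hleft T hT
      right_inv := hright T hT
      continuous_toFun := hΦc T hT
      continuous_invFun := hΨc T hT } else Homeomorph.refl F
  have hφ : ∀ T ∈ Icc (0 : ℝ) 1, ∀ y, φ T y = Φ y T := fun T hT y => by
    simp only [φ, dif_pos hT]
    rfl
  refine ⟨φ, fun y => ⟨?_, fun t ht => ?_⟩⟩
  · rw [hφ 0 (left_mem_Icc.2 zero_le_one), hΦ0]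
  · beta_reduce
    rw [hφ t ht]
    exact (hΦ y t ht).congr (fun s hs => hφ s hs y) (hφ t ht y)

end Flow

/-! ### The flow of a continuous curve in `V`. -/

section FlowOfField

open scoped NNReal

variable {n : ℕ} {V : Type*} [NormedAddCommGroup V] [InnerProductSpace ℝ V]
  [RKHS ℝ V (EuclideanSpace ℝ (Fin n)) (EuclideanSpace ℝ (Fin n))]

local notation "𝔼" => EuclideanSpace ℝ (Fin n)

/-- A continuous and bounded curve in `V` has a flow, and each of its integral curves follows this
flow. -/
theorem exists_isFlow (hV : EmbedsInC20 V) {v : ℝ → V} (hv : Continuous v) {M : ℝ}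
    (hM : ∀ t, ‖v t‖ ≤ M) :
    ∃ φ : ℝ → 𝔼 ≃ₜ 𝔼, IsFlow v φ ∧ ∀ x : ℝ → 𝔼,
      (∀ t ∈ Icc (0 : ℝ) 1, HasDerivWithinAt x (v t (x t)) (Icc 0 1) t) →
      ∀ t ∈ Icc (0 : ℝ) 1, φ t (x 0) = x t := by
  obtain ⟨c, hc0, hc, hl⟩ := hV.exists_bound
  have hM0 : 0 ≤ M := (norm_nonneg _).trans (hM 0)
  set K : ℝ≥0 := ⟨c * M, by positivity⟩ with hKdef
  have hlip : ∀ t, LipschitzWith K (fun y : 𝔼 => v t y) := fun t =>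
    LipschitzWith.of_dist_le_mul fun y z => by
      rw [dist_eq_norm, dist_eq_norm]
      refine (hl (v t) y z).trans ?_
      change _ ≤ c * M * ‖y - z‖
      gcongr
      exact hM t
  have hcont : ∀ y : 𝔼, Continuous fun t => v t y := fun y =>
    (RKHS.continuous_eval (𝕜 := ℝ) (H := V) y).comp hv
  obtain ⟨φ, hφ⟩ := exists_homeomorph_isODESolution (K := K) (L := K) hlip
    (fun t y => (hc (v t) y).trans (by change _ ≤ c * M; gcongr; exact hM t)) hcont
  have hjoint : Continuous fun p : 𝔼 × ℝ => v p.2 p.1 :=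
    continuous_prod_of_continuous_lipschitzWith _ K hcont hlip
  refine ⟨φ, fun y => ?_, fun x hx t ht => ?_⟩
  · have hφc : ContinuousOn (fun t => φ t y) (Icc 0 1) :=
      fun t ht => ((hφ y).2 t ht).continuousWithinAt
    have hvc : ContinuousOn (fun t => v t (φ t y)) (Icc 0 1) :=
      hjoint.comp_continuousOn (hφc.prodMk continuousOn_id)
    refine ⟨hvc.intervalIntegrable_of_Icc zero_le_one, fun t ht => ?_⟩
    rw [integral_eq_sub_of_hasDerivWithinAt_Icc (γ := fun t => φ t y) (hφ y).2 hvc le_rfl ht.1 ht.2,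
      (hφ y).1, add_sub_cancel]
  · exact IsODESolution.eq hlip ht.1 ((hφ (x 0)).2.mono ht.2)
      (IsODESolution.mono (f := fun t (y : 𝔼) => v t y) hx ht.2) (hφ (x 0)).1

end FlowOfField

/-! ### Cauchy-Schwarz on the unit interval and its equality case. -/

section UnitIntervalL2

/-- The variance identity yields both the inequality and the constancy of `f` in the equality case.
-/
lemma integral_sq_sub_integral {f : ℝ → ℝ} (hf : MemLp f 2 (volume.restrict (Icc (0 : ℝ) 1))) :
    ∫ t in Icc (0 : ℝ) 1, (f t - ∫ s in Icc (0 : ℝ) 1, f s) ^ 2 =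
      (∫ t in Icc (0 : ℝ) 1, f t ^ 2) - (∫ t in Icc (0 : ℝ) 1, f t) ^ 2 := by
  set a := ∫ s in Icc (0 : ℝ) 1, f s with ha
  have h1 : Integrable f (volume.restrict (Icc (0 : ℝ) 1)) := hf.integrable one_le_two
  have h2 := hf.integrable_sq
  have h3 : ∀ t, (f t - a) ^ 2 = f t ^ 2 - (2 * a * f t - a ^ 2) := fun t => by ring
  simp_rw [h3]
  have h4 : Integrable (fun t => 2 * a * f t - a ^ 2) (volume.restrict (Icc (0 : ℝ) 1)) :=
    (h1.const_mul _).sub (integrable_const _)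
  rw [integral_sub h2 h4, integral_sub (h1.const_mul _) (integrable_const _), integral_const_mul, ← ha]
  simp
  ring

lemma sq_integral_le_integral_sq {f : ℝ → ℝ}
    (hf : MemLp f 2 (volume.restrict (Icc (0 : ℝ) 1))) :
    (∫ t in Icc (0 : ℝ) 1, f t) ^ 2 ≤ ∫ t in Icc (0 : ℝ) 1, f t ^ 2 := by
  have h := integral_sq_sub_integral hf
  have : 0 ≤ ∫ t in Icc (0 : ℝ) 1, (f t - ∫ s in Icc (0 : ℝ) 1, f s) ^ 2 :=
    integral_nonneg fun _ => sq_nonneg _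
  linarith

lemma ae_eq_integral_of_integral_sq_le {f : ℝ → ℝ}
    (hf : MemLp f 2 (volume.restrict (Icc (0 : ℝ) 1)))
    (h : ∫ t in Icc (0 : ℝ) 1, f t ^ 2 ≤ (∫ t in Icc (0 : ℝ) 1, f t) ^ 2) :
    f =ᵐ[volume.restrict (Icc (0 : ℝ) 1)] fun _ => ∫ t in Icc (0 : ℝ) 1, f t := by
  have h1 := integral_sq_sub_integral hf
  have h2 : 0 ≤ ∫ t in Icc (0 : ℝ) 1, (f t - ∫ s in Icc (0 : ℝ) 1, f s) ^ 2 :=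
    integral_nonneg fun _ => sq_nonneg _
  have h3 : ∫ t in Icc (0 : ℝ) 1, (f t - ∫ s in Icc (0 : ℝ) 1, f s) ^ 2 = 0 := by linarith
  have h4 : MemLp (fun t => f t - ∫ s in Icc (0 : ℝ) 1, f s) 2 (volume.restrict (Icc (0 : ℝ) 1)) :=
    hf.sub (memLp_const _)
  rw [integral_eq_zero_iff_of_nonneg (fun _ => sq_nonneg _) h4.integrable_sq] at h3
  filter_upwards [h3] with t ht
  exact sub_eq_zero.1 (pow_eq_zero_iff two_ne_zero |>.1 ht)

lemma intervalIntegral_eq_of_ae_eq_const {f : ℝ → ℝ} {a s t : ℝ}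
    (hf : f =ᵐ[volume.restrict (Icc (0 : ℝ) 1)] fun _ => a) (hs : 0 ≤ s) (hst : s ≤ t)
    (ht : t ≤ 1) : ∫ r in s..t, f r = a * (t - s) := by
  have h : ∫ r in s..t, f r = ∫ _ in s..t, a := by
    rw [intervalIntegral.integral_of_le hst, intervalIntegral.integral_of_le hst]
    exact integral_congr_ae (ae_restrict_of_ae_restrict_of_subset
      (Ioc_subset_Icc_self.trans (Icc_subset_Icc hs ht)) hf)
  rw [h, intervalIntegral.integral_const, smul_eq_mul, mul_comm]

lemma intervalIntegral_zero_one_eq (f : ℝ → ℝ) :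
    ∫ t in (0 : ℝ)..1, f t = ∫ t in Icc (0 : ℝ) 1, f t := by
  rw [intervalIntegral.integral_of_le zero_le_one, integral_Icc_eq_integral_Ioc]

lemma lintegral_enorm_sq_eq_ofReal {W : Type*} [NormedAddCommGroup W] {μ : Measure ℝ} {f : ℝ → W}
    (hf : MemLp f 2 μ) : ∫⁻ t, ‖f t‖ₑ ^ 2 ∂μ = ENNReal.ofReal (∫ t, ‖f t‖ ^ 2 ∂μ) := by
  rw [ofReal_integral_eq_lintegral_ofReal (hf.integrable_norm_pow two_ne_zero)
    (ae_of_all _ fun _ => by positivity)]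
  refine lintegral_congr fun t => ?_
  rw [ENNReal.ofReal_pow (norm_nonneg _), ofReal_norm]

end UnitIntervalL2

/-! ### The control problem between multiples of Dirac masses. -/

section DiracMeasures

variable {n : ℕ} {V : Type*} [NormedAddCommGroup V] [InnerProductSpace ℝ V]
  [RKHS ℝ V (EuclideanSpace ℝ (Fin n)) (EuclideanSpace ℝ (Fin n))]

local notation "𝔼" => EuclideanSpace ℝ (Fin n)

lemma withDensity_dirac {α : Type*} [MeasurableSpace α] [MeasurableSingletonClass α] (x : α)
    (f : α → ℝ≥0∞) : (Measure.dirac x).withDensity f = f x • Measure.dirac x := by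
  classical
  ext s hs
  rw [withDensity_apply _ hs, setLIntegral_dirac]
  split_ifs with h <;> simp [h]

lemma transformedMeasure_smul_dirac {r₀ : ℝ} (hr₀ : 0 ≤ r₀) (x₀ : 𝔼) (φ : ℝ → 𝔼 ≃ₜ 𝔼)
    (η : ℝ → 𝔼 → ℝ) (t : ℝ) :
    transformedMeasure (ENNReal.ofReal r₀ • Measure.dirac x₀) φ η t =
      ENNReal.ofReal (r₀ * sqrtWeight η t x₀ ^ 2) • Measure.dirac (φ t x₀) := by
  rw [transformedMeasure, Measure.map_smul, Measure.map_dirac, withDensity_smul_measure,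
    withDensity_dirac, smul_smul, Homeomorph.symm_apply_apply, ENNReal.ofReal_mul hr₀]

/-- The total mass gives the weights; the position is recovered only from a nonzero mass, whence the
convention on `x₁` when `r₁ = 0`. -/
lemma ofReal_smul_dirac_eq {a b : ℝ} (ha : 0 ≤ a) (hb : 0 ≤ b) {x y : 𝔼}
    (h : ENNReal.ofReal a • Measure.dirac x = ENNReal.ofReal b • Measure.dirac y) :
    a = b ∧ (b ≠ 0 → x = y) := by
  have hab : a = b := by
    have := congrArg (fun m => m univ) h
    simp only [Measure.smul_apply, measure_univ, smul_eq_mul, mul_one] at this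
    exact (ENNReal.ofReal_eq_ofReal_iff ha hb).1 this
  refine ⟨hab, fun hb0 => ?_⟩
  by_contra hxy
  have h2 := congrArg (fun m => m {y}) h
  have h3 : 0 < b := lt_of_le_of_ne hb hb0.symm
  simp [hxy] at h2
  linarith

/-- Up to the factor `r₀`, the product measure is the image of `ν` under `t ↦ (t, x₀)`. -/
lemma memLp_section_of_memLp_prod_smul_dirac {r₀ : ℝ} (hr₀ : 0 < r₀) {x₀ : 𝔼} {η : ℝ → 𝔼 → ℝ}
    {ν : Measure ℝ} [SFinite ν]
    (h : MemLp (fun p : ℝ × 𝔼 => η p.1 p.2) 2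
      (ν.prod (ENNReal.ofReal r₀ • Measure.dirac x₀))) :
    MemLp (fun t => η t x₀) 2 ν := by
  have h0 : ENNReal.ofReal r₀ ≠ 0 := (ENNReal.ofReal_pos.2 hr₀).ne'
  rw [Measure.prod_smul_right, Measure.prod_dirac] at h
  have h1 := h.smul_measure (ENNReal.inv_ne_top.2 h0)
  rw [smul_smul, ENNReal.inv_mul_cancel h0 ENNReal.ofReal_ne_top, one_smul] at h1
  exact h1.comp_of_map (by fun_prop : AEMeasurable (fun t : ℝ => (t, x₀)) ν)

lemma lddmmFRCost_smul_dirac {γ : ℝ} (hγ : 0 ≤ γ) {r₀ : ℝ} (hr₀ : 0 ≤ r₀) (x₀ : 𝔼)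
    {W : Type*} [NormedAddCommGroup W] {v : ℝ → W} {η : ℝ → 𝔼 → ℝ} (φ : ℝ → 𝔼 ≃ₜ 𝔼)
    (hv : MemLp v 2 (volume.restrict (Icc (0 : ℝ) 1)))
    (hη : MemLp (fun t => η t x₀) 2 (volume.restrict (Icc (0 : ℝ) 1))) :
    lddmmFRCost γ (ENNReal.ofReal r₀ • Measure.dirac x₀) v η φ =
      ENNReal.ofReal (1 / 2 * (∫ t in Icc (0 : ℝ) 1, ‖v t‖ ^ 2) +
        γ / 2 * (r₀ * ∫ t in Icc (0 : ℝ) 1, η t x₀ ^ 2)) := by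
  have h1 : ∀ t, ∫⁻ y, ‖η t ((φ t).symm y)‖ₑ ^ 2
      ∂((ENNReal.ofReal r₀ • Measure.dirac x₀).map (φ t)) =
      ENNReal.ofReal r₀ * ‖η t x₀‖ₑ ^ 2 := fun t => by
    rw [Measure.map_smul, Measure.map_dirac, lintegral_smul_measure, lintegral_dirac,
      Homeomorph.symm_apply_apply, smul_eq_mul]
  have h2 := lintegral_enorm_sq_eq_ofReal hη
  simp only [Real.norm_eq_abs, sq_abs] at h2
  rw [lddmmFRCost]
  simp_rw [h1]
  rw [lintegral_const_mul' _ _ ENNReal.ofReal_ne_top, lintegral_enorm_sq_eq_ofReal hv, h2,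
    ← ENNReal.ofReal_mul (by norm_num), ← ENNReal.ofReal_mul hr₀,
    ← ENNReal.ofReal_mul (by positivity), ← ENNReal.ofReal_add]
  · exact mul_nonneg (by norm_num) (integral_nonneg fun _ => by positivity)
  · exact mul_nonneg (by positivity) (mul_nonneg hr₀ (integral_nonneg fun _ => by positivity))

/-- The numerical consequences of admissibility between multiples of Dirac masses. -/
lemma IsAdmissible.sqrtWeight_one {r₀ r₁ : ℝ} (hr₀ : 0 < r₀) (hr₁ : 0 ≤ r₁) {x₀ x₁ : 𝔼}
    {v : ℝ → V} {η : ℝ → 𝔼 → ℝ} {φ : ℝ → 𝔼 ≃ₜ 𝔼}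
    (h : IsAdmissible (ENNReal.ofReal r₀ • Measure.dirac x₀)
      (ENNReal.ofReal r₁ • Measure.dirac x₁) v η φ) :
    √r₀ * ∫ t in Icc (0 : ℝ) 1, η t x₀ = 2 * (√r₁ - √r₀) ∧ (r₁ ≠ 0 → φ 1 x₀ = x₁) := by
  have h0 : ENNReal.ofReal r₀ ≠ 0 := (ENNReal.ofReal_pos.2 hr₀).ne'
  have htarget := h.target
  rw [transformedMeasure_smul_dirac hr₀.le] at htarget
  obtain ⟨hm, hx⟩ := ofReal_smul_dirac_eq (by positivity) hr₁ htarget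
  refine ⟨?_, hx⟩
  have hnn := h.nonneg
  rw [Measure.ae_ennreal_smul_measure_eq h0, ae_dirac_eq] at hnn
  -- The sign condition selects the branch when the square root of the final mass is taken.
  have hα : 0 ≤ sqrtWeight η 1 x₀ := hnn 1 (right_mem_Icc.2 zero_le_one)
  have h2 : √r₁ = √r₀ * sqrtWeight η 1 x₀ := by
    rw [← hm, Real.sqrt_mul hr₀.le, Real.sqrt_sq hα]
  rw [h2, sqrtWeight, intervalIntegral_zero_one_eq]
  ring

lemma IsFlow.map_zero {v : ℝ → V} {φ : ℝ → 𝔼 ≃ₜ 𝔼} (h : IsFlow v φ) (x : 𝔼) : φ 0 x = x := by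
  simpa using (h x).2 0 (left_mem_Icc.2 zero_le_one)

lemma IsAdmissible.memLp_section {r₀ : ℝ} (hr₀ : 0 < r₀) {x₀ : 𝔼} {μ' : Measure 𝔼}
    {v : ℝ → V} {η : ℝ → 𝔼 → ℝ} {φ : ℝ → 𝔼 ≃ₜ 𝔼}
    (h : IsAdmissible (ENNReal.ofReal r₀ • Measure.dirac x₀) μ' v η φ) :
    MemLp (fun t => η t x₀) 2 (volume.restrict (Icc (0 : ℝ) 1)) :=
  memLp_section_of_memLp_prod_smul_dirac hr₀ h.memLp_η

variable [CompleteSpace V]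

lemma IsAdmissible.kernelDist_le (hV : EmbedsInC20 V)
    (hK : ∀ x : 𝔼, (RKHS.kernel V x x).IsInvertible) {μ μ' : Measure 𝔼}
    {v : ℝ → V} {η : ℝ → 𝔼 → ℝ} {φ : ℝ → 𝔼 ≃ₜ 𝔼} (h : IsAdmissible μ μ' v η φ) (x₀ : 𝔼)
    {s t : ℝ} (hs : s ∈ Icc (0 : ℝ) 1) (ht : t ∈ Icc (0 : ℝ) 1) (hst : s ≤ t) :
    kernelDist V (φ s x₀) (φ t x₀) ≤ ∫ r in s..t, ‖v r‖ := by
  refine kernelDist_le_integral_norm hV hK (x := fun t => φ t x₀) ?_ (h.flow x₀).1 (h.flow x₀).2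
    hs ht hst
  have h1 : Integrable v (volume.restrict (Icc (0 : ℝ) 1)) := h.memLp_v.integrable one_le_two
  rw [intervalIntegrable_iff_integrableOn_Icc_of_le zero_le_one]
  exact h1.norm

lemma IsAdmissible.kernelDist_le_integral_norm (hV : EmbedsInC20 V)
    (hK : ∀ x : 𝔼, (RKHS.kernel V x x).IsInvertible)
    {r₀ r₁ : ℝ} (hr₀ : 0 < r₀) (hr₁ : 0 ≤ r₁) {x₀ x₁ : 𝔼} (h₁ : r₁ = 0 → x₁ = x₀)
    {v : ℝ → V} {η : ℝ → 𝔼 → ℝ} {φ : ℝ → 𝔼 ≃ₜ 𝔼}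
    (h : IsAdmissible (ENNReal.ofReal r₀ • Measure.dirac x₀)
      (ENNReal.ofReal r₁ • Measure.dirac x₁) v η φ) :
    kernelDist V x₀ x₁ ≤ ∫ t in Icc (0 : ℝ) 1, ‖v t‖ := by
  by_cases hr : r₁ = 0
  · rw [h₁ hr, kernelDist_self hK]
    exact integral_nonneg fun _ => norm_nonneg _
  · have := h.kernelDist_le hV hK x₀ (left_mem_Icc.2 zero_le_one) (right_mem_Icc.2 zero_le_one)
      zero_le_one
    rwa [h.flow.map_zero, (h.sqrtWeight_one hr₀ hr₁).2 hr, intervalIntegral_zero_one_eq] at this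

/-- Both parts of the cost of an admissible control are bounded below. -/
lemma IsAdmissible.energy_bounds (hV : EmbedsInC20 V)
    (hK : ∀ x : 𝔼, (RKHS.kernel V x x).IsInvertible)
    {r₀ r₁ : ℝ} (hr₀ : 0 < r₀) (hr₁ : 0 ≤ r₁) {x₀ x₁ : 𝔼} (h₁ : r₁ = 0 → x₁ = x₀)
    {v : ℝ → V} {η : ℝ → 𝔼 → ℝ} {φ : ℝ → 𝔼 ≃ₜ 𝔼}
    (h : IsAdmissible (ENNReal.ofReal r₀ • Measure.dirac x₀)
      (ENNReal.ofReal r₁ • Measure.dirac x₁) v η φ) :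
    kernelDist V x₀ x₁ ^ 2 ≤ ∫ t in Icc (0 : ℝ) 1, ‖v t‖ ^ 2 ∧
      4 * (√r₁ - √r₀) ^ 2 ≤ r₀ * ∫ t in Icc (0 : ℝ) 1, η t x₀ ^ 2 := by
  constructor
  · calc _ ≤ (∫ t in Icc (0 : ℝ) 1, ‖v t‖) ^ 2 := by
          gcongr
          · exact kernelDist_nonneg _ _
          · exact h.kernelDist_le_integral_norm hV hK hr₀ hr₁ h₁
      _ ≤ _ := sq_integral_le_integral_sq h.memLp_v.norm
  · calc 4 * (√r₁ - √r₀) ^ 2 = (2 * (√r₁ - √r₀)) ^ 2 := by ring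
      _ = r₀ * (∫ t in Icc (0 : ℝ) 1, η t x₀) ^ 2 := by
          rw [← (h.sqrtWeight_one hr₀ hr₁).1, mul_pow, Real.sq_sqrt hr₀.le]
      _ ≤ _ := by
          gcongr
          exact sq_integral_le_integral_sq (h.memLp_section hr₀)

/-- If both bounds are attained then the control follows a geodesic, at the stated weights. -/
lemma IsAdmissible.geodesic_of_energy_le (hV : EmbedsInC20 V)
    (hK : ∀ x : 𝔼, (RKHS.kernel V x x).IsInvertible)
    {r₀ r₁ : ℝ} (hr₀ : 0 < r₀) (hr₁ : 0 ≤ r₁) {x₀ x₁ : 𝔼} (h₁ : r₁ = 0 → x₁ = x₀)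
    {v : ℝ → V} {η : ℝ → 𝔼 → ℝ} {φ : ℝ → 𝔼 ≃ₜ 𝔼}
    (h : IsAdmissible (ENNReal.ofReal r₀ • Measure.dirac x₀)
      (ENNReal.ofReal r₁ • Measure.dirac x₁) v η φ)
    (hv : ∫ t in Icc (0 : ℝ) 1, ‖v t‖ ^ 2 ≤ kernelDist V x₀ x₁ ^ 2)
    (hη : r₀ * ∫ t in Icc (0 : ℝ) 1, η t x₀ ^ 2 ≤ 4 * (√r₁ - √r₀) ^ 2) :
    IsKernelGeodesic V x₀ x₁ (fun t => φ t x₀) ∧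
      ∀ t ∈ Icc (0 : ℝ) 1, r₀ * sqrtWeight η t x₀ ^ 2 = ((1 - t) * √r₀ + t * √r₁) ^ 2 := by
  have hI0 : (0 : ℝ) ∈ Icc (0 : ℝ) 1 := left_mem_Icc.2 zero_le_one
  have hI1 : (1 : ℝ) ∈ Icc (0 : ℝ) 1 := right_mem_Icc.2 zero_le_one
  constructor
  · have hle := h.kernelDist_le_integral_norm hV hK hr₀ hr₁ h₁
    have hnn : 0 ≤ ∫ t in Icc (0 : ℝ) 1, ‖v t‖ := integral_nonneg fun _ => norm_nonneg _
    have hcs := sq_integral_le_integral_sq h.memLp_v.norm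
    -- Cauchy-Schwarz is squeezed to an equality, so `‖v‖` is almost everywhere the distance.
    have heq : ∫ t in Icc (0 : ℝ) 1, ‖v t‖ = kernelDist V x₀ x₁ :=
      le_antisymm ((sq_le_sq₀ hnn (kernelDist_nonneg _ _)).1 (hcs.trans hv)) hle
    have hae := ae_eq_integral_of_integral_sq_le h.memLp_v.norm (by rw [heq]; exact hv)
    rw [heq] at hae
    have hLip : ∀ s ∈ Icc (0 : ℝ) 1, ∀ t ∈ Icc (0 : ℝ) 1, s ≤ t →
        kernelDist V (φ s x₀) (φ t x₀) ≤ kernelDist V x₀ x₁ * (t - s) := fun s hs t ht hst =>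
      (h.kernelDist_le hV hK x₀ hs ht hst).trans_eq
        (intervalIntegral_eq_of_ae_eq_const hae hs.1 hst ht.2)
    refine isKernelGeodesic_of_kernelDist_le hV hK (h.flow.map_zero x₀) ?_ hLip
    -- A zero target says nothing about `φ 1 x₀`; here the distance is zero and the Lipschitz bound
    -- brings the flow line back to `x₀`.
    by_cases hr : r₁ = 0
    · have h0 := hLip 0 hI0 1 hI1 zero_le_one
      rw [h₁ hr, kernelDist_self hK, zero_mul, h.flow.map_zero] at h0
      obtain ⟨c, hc0, hc, -⟩ := hV.exists_bound
      have h2 := norm_sub_le_mul_kernelDist hV hK hc0.le hc x₀ (φ 1 x₀)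
      rw [le_antisymm h0 (kernelDist_nonneg _ _), mul_zero] at h2
      rw [h₁ hr]
      exact (sub_eq_zero.1 (norm_le_zero_iff.1 h2)).symm
    · exact (h.sqrtWeight_one hr₀ hr₁).2 hr
  · intro t ht
    have hone := (h.sqrtWeight_one hr₀ hr₁).1
    have hsec := h.memLp_section hr₀
    have hsq : 4 * (√r₁ - √r₀) ^ 2 = r₀ * (∫ t in Icc (0 : ℝ) 1, η t x₀) ^ 2 := by
      rw [← Real.sq_sqrt hr₀.le, ← mul_pow, Real.sq_sqrt hr₀.le, hone]
      ring
    have hae := ae_eq_integral_of_integral_sq_le hsec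
      (le_of_mul_le_mul_left (hη.trans_eq hsq) hr₀)
    have hint := intervalIntegral_eq_of_ae_eq_const hae le_rfl ht.1 ht.2
    rw [sqrtWeight, hint, ← Real.sq_sqrt hr₀.le, ← mul_pow, Real.sq_sqrt hr₀.le]
    congr 1
    linear_combination (t / 2) * hone

/-- Every geodesic of the kernel metric is followed by an optimal control. -/
lemma exists_isAdmissible_of_isKernelGeodesic (hV : EmbedsInC20 V)
    (hK : ∀ x : 𝔼, (RKHS.kernel V x x).IsInvertible) {γ : ℝ} (hγ : 0 ≤ γ)
    {r₀ r₁ : ℝ} (hr₀ : 0 < r₀) (hr₁ : 0 ≤ r₁) {x₀ x₁ : 𝔼} {x : ℝ → 𝔼}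
    (hx : IsKernelGeodesic V x₀ x₁ x) :
    ∃ (v : ℝ → V) (η : ℝ → 𝔼 → ℝ) (φ : ℝ → 𝔼 ≃ₜ 𝔼),
      IsAdmissible (ENNReal.ofReal r₀ • Measure.dirac x₀)
        (ENNReal.ofReal r₁ • Measure.dirac x₁) v η φ ∧
      lddmmFRCost γ (ENNReal.ofReal r₀ • Measure.dirac x₀) v η φ =
        ENNReal.ofReal (1 / 2 * kernelDist V x₀ x₁ ^ 2 + 2 * γ * (√r₁ - √r₀) ^ 2) ∧
      ∀ t ∈ Icc (0 : ℝ) 1, transformedMeasure (ENNReal.ofReal r₀ • Measure.dirac x₀) φ η t =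
        ENNReal.ofReal (((1 - t) * √r₀ + t * √r₁) ^ 2) • Measure.dirac (x t) := by
  have hI0 : (0 : ℝ) ∈ Icc (0 : ℝ) 1 := left_mem_Icc.2 zero_le_one
  have hI1 : (1 : ℝ) ∈ Icc (0 : ℝ) 1 := right_mem_Icc.2 zero_le_one
  set D := kernelDist V x₀ x₁ with hD
  set x' := derivWithin x (Icc 0 1) with hx'
  obtain ⟨hxd, hxc⟩ := (contDiffOn_one_iff_derivWithin (uniqueDiffOn_Icc one_pos)).1 hx.contDiffOn
  set u : ℝ → V := fun t => minLift V (x t) (x' t) with hu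
  have huc : ContinuousOn u (Icc 0 1) :=
    ((continuous_minLift hV hK).comp_continuousOn hxd.continuousOn).clm_apply hxc
  have huD : ∀ t ∈ Icc (0 : ℝ) 1, ‖u t‖ = D := fun t ht => by
    have := hx.speed t ht
    rw [kernelSpeed_eq (hK _)] at this
    rw [hD, kernelDist, ← this, toReal_enorm]
  -- Extension by the end values keeps continuity and the constant norm on all of `ℝ`, as the
  -- construction of the flow requires.
  set v : ℝ → V := IccExtend (zero_le_one' ℝ) ((Icc (0 : ℝ) 1).domRestrict u) with hv
  have hvc : Continuous v := (continuousOn_iff_continuous_domRestrict.1 huc).Icc_extend'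
  have hvu : ∀ t ∈ Icc (0 : ℝ) 1, v t = u t := fun t ht => IccExtend_of_mem _ _ ht
  have hvD : ∀ t, ‖v t‖ = D := fun t => huD _ (projIcc 0 1 zero_le_one t).2
  obtain ⟨φ, hφ, hφx⟩ := exists_isFlow hV hvc (fun t => (hvD t).le)
  have hφx' : ∀ t ∈ Icc (0 : ℝ) 1, φ t x₀ = x t := by
    have := hφx x fun t ht => by
      rw [hvu t ht, hu, minLift_apply_self (hK _)]
      exact (hxd t ht).hasDerivWithinAt
    rwa [hx.source] at this
  have hs0 : √r₀ ≠ 0 := (Real.sqrt_pos.2 hr₀).ne'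
  -- The constant `η` for which `√r₀ * (1 + e / 2) = √r₁`.
  set e := 2 * (√r₁ - √r₀) / √r₀ with he
  have hweight : ∀ t, sqrtWeight (fun _ (_ : 𝔼) => e) t x₀ = ((1 - t) * √r₀ + t * √r₁) / √r₀ := by
    intro t
    rw [sqrtWeight, intervalIntegral.integral_const, he, smul_eq_mul]
    field_simp
    ring
  have hr₀e : r₀ = √r₀ ^ 2 := (Real.sq_sqrt hr₀.le).symm
  have htrans : ∀ t ∈ Icc (0 : ℝ) 1,
      transformedMeasure (ENNReal.ofReal r₀ • Measure.dirac x₀) φ (fun _ _ => e) t =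
        ENNReal.ofReal (((1 - t) * √r₀ + t * √r₁) ^ 2) • Measure.dirac (x t) := by
    intro t ht
    rw [transformedMeasure_smul_dirac hr₀.le, hφx' t ht, hweight]
    congr 2
    rw [div_pow, ← hr₀e]
    field_simp
  have hfin : IsFiniteMeasure (ENNReal.ofReal r₀ • Measure.dirac x₀) :=
    Measure.smul_finite _ ENNReal.ofReal_ne_top
  have hvL : MemLp v 2 (volume.restrict (Icc (0 : ℝ) 1)) :=
    MemLp.of_bound hvc.aestronglyMeasurable D (ae_of_all _ fun t => (hvD t).le)
  refine ⟨v, fun _ _ => e, φ, ⟨hvL, memLp_const _, hφ, ?_, ?_⟩, ?_, htrans⟩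
  · rw [Measure.ae_ennreal_smul_measure_eq (ENNReal.ofReal_pos.2 hr₀).ne', ae_dirac_eq]
    change ∀ t ∈ Icc (0 : ℝ) 1, 0 ≤ sqrtWeight (fun _ _ => e) t x₀
    intro t ht
    rw [hweight]
    have := ht.1
    have := sub_nonneg.2 ht.2
    positivity
  · rw [htrans 1 hI1, hx.target]
    simp [Real.sq_sqrt hr₁]
  · rw [lddmmFRCost_smul_dirac hγ hr₀.le x₀ φ hvL (memLp_const _)]
    congr 1
    simp only [hvD, integral_const, measureReal_restrict_apply_univ, Real.volume_real_Icc,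
      sub_zero, smul_eq_mul]
    rw [he, div_pow, ← hr₀e]
    field_simp
    norm_num

theorem lddmmFREDist_smul_dirac (hV : EmbedsInC20 V)
    (hK : ∀ x : 𝔼, (RKHS.kernel V x x).IsInvertible) {γ : ℝ} (hγ : 0 ≤ γ)
    {r₀ r₁ : ℝ} (hr₀ : 0 < r₀) (hr₁ : 0 ≤ r₁) {x₀ x₁ : 𝔼} (h₁ : r₁ = 0 → x₁ = x₀) :
    lddmmFREDist V γ (ENNReal.ofReal r₀ • Measure.dirac x₀)
      (ENNReal.ofReal r₁ • Measure.dirac x₁) =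
      ENNReal.ofReal (1 / 2 * kernelDist V x₀ x₁ ^ 2 + 2 * γ * (√r₁ - √r₀) ^ 2) ^ (1 / 2 : ℝ) := by
  rw [lddmmFREDist]
  congr 1
  apply le_antisymm
  · obtain ⟨x, hx⟩ := exists_isKernelGeodesic hV hK x₀ x₁
    obtain ⟨v, η, φ, hadm, hcost, -⟩ :=
      exists_isAdmissible_of_isKernelGeodesic hV hK hγ hr₀ hr₁ hx
    rw [← hcost]
    exact iInf_le_of_le v (iInf_le_of_le η (iInf_le_of_le φ (iInf_le _ hadm)))
  · refine le_iInf fun v => le_iInf fun η => le_iInf fun φ => le_iInf fun h => ?_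
    rw [lddmmFRCost_smul_dirac hγ hr₀.le x₀ φ h.memLp_v (h.memLp_section hr₀)]
    obtain ⟨e1, e2⟩ := h.energy_bounds hV hK hr₀ hr₁ h₁
    refine ENNReal.ofReal_le_ofReal ?_
    have := mul_le_mul_of_nonneg_left e2 (by positivity : 0 ≤ γ / 2)
    linarith

end DiracMeasures

end

theorem mainTheorem6 {n : ℕ} {V : Type*} [NormedAddCommGroup V] [InnerProductSpace ℝ V]
    [CompleteSpace V] [RKHS ℝ V (EuclideanSpace ℝ (Fin n)) (EuclideanSpace ℝ (Fin n))]
    (hV : EmbedsInC20 V)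
    (hK : ∀ x : EuclideanSpace ℝ (Fin n), (RKHS.kernel V x x).IsInvertible)
    {γ : ℝ} (hγ : 0 < γ) {r₀ r₁ : ℝ} (hr₀ : 0 < r₀) (hr₁ : 0 ≤ r₁)
    (x₀ x₁ : EuclideanSpace ℝ (Fin n)) (h₁ : r₁ = 0 → x₁ = x₀) :
    -- the distance
    (kernelEDist V x₀ x₁ ≠ ∞ ∧
      lddmmFREDist V γ (ENNReal.ofReal r₀ • Measure.dirac x₀)
        (ENNReal.ofReal r₁ • Measure.dirac x₁) ≠ ∞ ∧
      (lddmmFREDist V γ (ENNReal.ofReal r₀ • Measure.dirac x₀)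
        (ENNReal.ofReal r₁ • Measure.dirac x₁)).toReal ^ 2 =
        1 / 2 * (kernelEDist V x₀ x₁).toReal ^ 2 + 2 * γ * (√r₁ - √r₀) ^ 2) ∧
    -- the geodesics
    (∃ x : ℝ → EuclideanSpace ℝ (Fin n), IsKernelGeodesic V x₀ x₁ x) ∧
    ∀ m : ℝ → Measure (EuclideanSpace ℝ (Fin n)),
      IsLDDMMFRGeodesic V γ (ENNReal.ofReal r₀ • Measure.dirac x₀)
        (ENNReal.ofReal r₁ • Measure.dirac x₁) m ↔
      ∃ x : ℝ → EuclideanSpace ℝ (Fin n), IsKernelGeodesic V x₀ x₁ x ∧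
        ∀ t ∈ Icc (0 : ℝ) 1,
          m t = ENNReal.ofReal (((1 - t) * √r₀ + t * √r₁) ^ 2) • Measure.dirac (x t) := by
  have hdist := lddmmFREDist_smul_dirac hV hK hγ.le hr₀ hr₁ h₁
  have hpos : 0 ≤ 1 / 2 * kernelDist V x₀ x₁ ^ 2 + 2 * γ * (√r₁ - √r₀) ^ 2 := by positivity
  refine ⟨⟨kernelEDist_ne_top hV hK x₀ x₁, ?_, ?_⟩, exists_isKernelGeodesic hV hK x₀ x₁,
    fun m => ⟨?_, ?_⟩⟩
  · rw [hdist]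
    exact ENNReal.rpow_ne_top_of_nonneg (by norm_num) ENNReal.ofReal_ne_top
  · rw [hdist, ← ENNReal.toReal_rpow, ENNReal.toReal_ofReal hpos, ← Real.sqrt_eq_rpow,
      Real.sq_sqrt hpos]
    rfl
  · rintro ⟨v, η, φ, h, hopt, hm⟩
    rw [hdist, (ENNReal.rpow_left_injective (x := 1 / 2) (by norm_num)).eq_iff,
      lddmmFRCost_smul_dirac hγ.le hr₀.le x₀ φ h.memLp_v (h.memLp_section hr₀)] at hopt
    -- Both terms of the cost are bounded below and their sum equals the sum of the bounds, so each
    -- bound is attained; `γ > 0` allows dividing the second by `γ / 2`.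
    obtain ⟨e1, e2⟩ := h.energy_bounds hV hK hr₀ hr₁ h₁
    have e3 := mul_le_mul_of_nonneg_left e2 (by positivity : 0 ≤ γ / 2)
    rw [ENNReal.ofReal_eq_ofReal_iff hpos (by linarith)] at hopt
    obtain ⟨hgeo, hw⟩ := h.geodesic_of_energy_le hV hK hr₀ hr₁ h₁ (by linarith)
      (le_of_mul_le_mul_left (by linarith) (by positivity : 0 < γ / 2))
    exact ⟨_, hgeo, fun t ht => by
      rw [hm t ht, transformedMeasure_smul_dirac hr₀.le, hw t ht]⟩
  · rintro ⟨x, hx, hm⟩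
    obtain ⟨v, η, φ, hadm, hcost, htrans⟩ :=
      exists_isAdmissible_of_isKernelGeodesic hV hK hγ.le hr₀ hr₁ hx
    exact ⟨v, η, φ, hadm, by rw [hdist, hcost], fun t ht => by rw [hm t ht, htrans t ht]⟩
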